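/- **Setting.** Let $\mu$ be a $\sigma$-finite measure on a measurable space $\mathcal X$ (write $dx$ for $\mu(dx)$), let $\Omega\subset\mathbb R^s$ be a parameter space, $\{f_\theta:\theta\in\Omega\}$ a family of probability densities with respect to $\mu$, with distributions $F_\theta$, and let $G$ be a distribution with density $g$ with respect to $\mu$, not necessarily in the family. Let $B$ be a function that is strictly convex and twice differentiable on $(0,\infty)$. Put $u_\theta(x)=\nabla_\theta\log f_\theta(x)$ and $$V_\theta(x)=\int\big[f_\theta(y)B'(f_\theta(y))-B(f_\theta(y))\big]dy-B'(f_\theta(x)).$$ Let $\nabla_{kl}$ and $\nabla_{jkl}$ denote second and third partial derivatives with respect to $\theta$, and let $E_g$ be expectation under $G$. Let $\theta_g\in\Omega$ be a best-fitting parameter, i.e. a root of the theoretical estimating equation $$\int u_\theta B''(f_\theta)f_\theta\,dG=\int u_\theta B''(f_\theta)f_\theta\,dF_\theta .$$ Define the $s\times s$ matrices $$J_{kl}(\theta)=E_g\big[\nabla_{kl}V_\theta(X)\big],\qquad K(\theta)=\int u_\theta u_\theta^{T}\,[B''(f_\theta)f_\theta]^2\,dG-\xi(\theta)\xi(\theta)^T,\qquad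 \xi(\theta)=\int u_\theta B''(f_\theta)f_\theta\,dG,$$ and write $J=J(\theta_g)$, $K=K(\theta_g)$. **Assumptions.** * (A1) The set $\chi=\{x:f_\theta(x)>0\}$ does not depend on $\theta\in\Omega$; $G$ is supported on $\chi$, and $g>0$ on $\chi$. * (A2) There is an open set $\omega\subset\Omega$ containing $\theta_g$ such that for almost all $x\in\chi$ the function $\theta\mapsto f_\theta(x)$ is three times differentiable on $\omega$ with continuous third partial derivatives. * (A3) On $\omega$, the integrals $\int[f_\theta(x)B'(f_\theta(x))-B(f_\theta(x))]\,dx$ and $\int B'(f_\theta(x))g(x)\,dx$ can be differentiated three times with respect to $\theta$, and the derivatives can be taken under the integral sign: the integrals converge absolutely, for almost every $x$ the integrands are three times differentiable in $\theta\in\omega$, and each partial derivative of order at most three of the integral is the absolutely convergent integral of the corresponding partial derivative of the integrand. * (A4) $J$ is positive definite. * (A5) There are functions $M_{jkl}$ with $E_g[M_{jkl}(X)]<\infty$ such that, for $G$-almost every $x$, $|\nabla_{jkl}V_\theta(x)|\le M_{jkl}(x)$ for all $\theta\in\omega$ and all $j,k,l$. **Theorem.** Let $X_1,X_2,\dots$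 be i.i.d. with distribution $G$ and assume (A1)–(A5). 1. The minimum Bregman divergence estimating equation $$\frac1n\sum_{i=1}^n u_\theta(X_i)\,B''(f_\theta(X_i))\,f_\theta(X_i)=\int u_\theta(x)\,B''(f_\theta(x))\,f_\theta^2(x)\,dx$$ has a consistent sequence of roots: there are statistics $\hat\theta_n=\hat\theta_n(X_1,\dots,X_n)$ such that, with probability tending to $1$, $\hat\theta_n$ lies in $\Omega$ and solves the equation, and $\hat\theta_n\to\theta_g$ in probability. 2. If moreover $K$ is finite, i.e. $E_g\|u_{\theta_g}(X)B''(f_{\theta_g}(X))f_{\theta_g}(X)\|^2<\infty$, then for every such consistent sequence of roots $\sqrt n(\hat\theta_n-\theta_g)$ converges in distribution to the $s$-dimensional normal distribution with mean $0$ and covariance matrix $J^{-1}KJ^{-1}$. -/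

import Mathlib

open MeasureTheory ProbabilityTheory Filter Topology

namespace MinBregman

noncomputable section

/-- The ambient space `ℝ^s` of the parameter, with its Euclidean norm. -/
abbrev Param (s : ℕ) := EuclideanSpace ℝ (Fin s)

/-- The `k`-th partial derivative of `F` at `θ`. -/
def pd {s : ℕ} (k : Fin s) (F : Param s → ℝ) (θ : Param s) : ℝ :=
  fderiv ℝ F θ (EuclideanSpace.single k 1)

/-- `F` is three times differentiable on (the open set) `ω`. -/
def ThriceDiffOn {s : ℕ} (F : Param s → ℝ) (ω : Set (Param s)) : Prop :=
  DifferentiableOn ℝ F ω ∧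
  (∀ j, DifferentiableOn ℝ (pd j F) ω) ∧
  (∀ j k, DifferentiableOn ℝ (pd j (pd k F)) ω)

/-- The integral `∫ φ_θ(x) dμ(x)` can be differentiated three times with respect to `θ` on `ω`,
and all the derivatives can be taken under the integral sign. -/
structure DiffUnderIntegral {s : ℕ} {𝒳 : Type*} [MeasurableSpace 𝒳] (μ : Measure 𝒳)
    (φ : Param s → 𝒳 → ℝ) (ω : Set (Param s)) : Prop where
  integrable : ∀ θ ∈ ω, Integrable (φ θ) μ
  pointwise : ∀ᵐ x ∂μ, ThriceDiffOn (fun t ↦ φ t x) ω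
  integral : ThriceDiffOn (fun t ↦ ∫ x, φ t x ∂μ) ω
  first : ∀ θ ∈ ω, ∀ j,
    Integrable (fun x ↦ pd j (fun t ↦ φ t x) θ) μ ∧
    pd j (fun t ↦ ∫ x, φ t x ∂μ) θ = ∫ x, pd j (fun t ↦ φ t x) θ ∂μ
  second : ∀ θ ∈ ω, ∀ j k,
    Integrable (fun x ↦ pd j (pd k (fun t ↦ φ t x)) θ) μ ∧
    pd j (pd k (fun t ↦ ∫ x, φ t x ∂μ)) θ = ∫ x, pd j (pd k (fun t ↦ φ t x)) θ ∂μ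
  third : ∀ θ ∈ ω, ∀ j k l,
    Integrable (fun x ↦ pd j (pd k (pd l (fun t ↦ φ t x))) θ) μ ∧
    pd j (pd k (pd l (fun t ↦ ∫ x, φ t x ∂μ))) θ
      = ∫ x, pd j (pd k (pd l (fun t ↦ φ t x))) θ ∂μ

/-- `p` is a probability density with respect to `μ`. -/
structure IsDensity {𝒳 : Type*} [MeasurableSpace 𝒳] (μ : Measure 𝒳) (p : 𝒳 → ℝ) : Prop where
  measurable : Measurable p
  nonneg : ∀ x, 0 ≤ p x
  lintegral_eq_one : ∫⁻ x, ENNReal.ofReal (p x) ∂μ = 1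

/-- The distribution with density `p` with respect to `μ`. -/
def distr {𝒳 : Type*} [MeasurableSpace 𝒳] (μ : Measure 𝒳) (p : 𝒳 → ℝ) : Measure 𝒳 :=
  μ.withDensity fun x ↦ ENNReal.ofReal (p x)

/-- A convex function generating a Bregman divergence between densities: strictly convex and
twice differentiable on `(0, ∞)`. -/
structure IsBregmanGenerator (B : ℝ → ℝ) : Prop where
  strictConvex : StrictConvexOn ℝ (Set.Ioi 0) B
  diff : DifferentiableOn ℝ B (Set.Ioi 0)
  diff_deriv : DifferentiableOn ℝ (deriv B) (Set.Ioi 0)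

section Objects

variable {s : ℕ} {𝒳 : Type*} [MeasurableSpace 𝒳]

/-- The likelihood score `u_θ(x) = ∇_θ log f_θ(x)`. -/
def score (f : Param s → 𝒳 → ℝ) (θ : Param s) (x : 𝒳) : Param s :=
  gradient (fun t ↦ Real.log (f t x)) θ

/-- The weighted score `u_θ(x) B''(f_θ(x)) f_θ(x)`. -/
def wscore (B : ℝ → ℝ) (f : Param s → 𝒳 → ℝ) (θ : Param s) (x : 𝒳) : Param s :=
  (deriv (deriv B) (f θ x) * f θ x) • score f θ x

/-- The minimum Bregman divergence estimating equation, at the parameter value `θ`, for the sample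
`x`: `n⁻¹ ∑ u_θ(x_i) B''(f_θ(x_i)) f_θ(x_i) = ∫ u_θ(y) B''(f_θ(y)) f_θ(y)² dμ(y)`. -/
def EstimatingEq (μ : Measure 𝒳) (B : ℝ → ℝ) (f : Param s → 𝒳 → ℝ) {n : ℕ} (x : Fin n → 𝒳)
    (θ : Param s) : Prop :=
  (n : ℝ)⁻¹ • ∑ i, wscore B f θ (x i) = ∫ y, f θ y • wscore B f θ y ∂μ

/-- `θ` is a best fitting parameter for the distribution with density `g`: it lies in the parameter
space and solves the theoretical estimating equation
`∫ u_θ B''(f_θ) f_θ dG = ∫ u_θ B''(f_θ) f_θ dF_θ`. -/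
def IsBestFitting (μ : Measure 𝒳) (B : ℝ → ℝ) (f : Param s → 𝒳 → ℝ) (g : 𝒳 → ℝ)
    (Ω : Set (Param s)) (θ : Param s) : Prop :=
  θ ∈ Ω ∧ ∫ x, wscore B f θ x ∂(distr μ g) = ∫ x, wscore B f θ x ∂(distr μ (f θ))

/-- The integrand `f_θ(x) B'(f_θ(x)) - B(f_θ(x))`. -/
def penalty (B : ℝ → ℝ) (f : Param s → 𝒳 → ℝ) (θ : Param s) (x : 𝒳) : ℝ :=
  f θ x * deriv B (f θ x) - B (f θ x)

/-- `V_θ(x) = ∫ [f_θ B'(f_θ) - B(f_θ)] dμ - B'(f_θ(x))`. -/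
def V (μ : Measure 𝒳) (B : ℝ → ℝ) (f : Param s → 𝒳 → ℝ) (θ : Param s) (x : 𝒳) : ℝ :=
  (∫ y, penalty B f θ y ∂μ) - deriv B (f θ x)

/-- The matrix `J(θ)` with entries `E_g[∇_{kl} V_θ(X)]`. -/
def J (μ : Measure 𝒳) (B : ℝ → ℝ) (f : Param s → 𝒳 → ℝ) (g : 𝒳 → ℝ) (θ : Param s) :
    Matrix (Fin s) (Fin s) ℝ :=
  Matrix.of fun k l ↦ ∫ x, pd k (pd l (fun t ↦ V μ B f t x)) θ ∂(distr μ g)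

/-- `ξ(θ) = ∫ u_θ B''(f_θ) f_θ dG`. -/
def xi (μ : Measure 𝒳) (B : ℝ → ℝ) (f : Param s → 𝒳 → ℝ) (g : 𝒳 → ℝ) (θ : Param s) : Param s :=
  ∫ x, wscore B f θ x ∂(distr μ g)

/-- The matrix `K(θ) = ∫ u_θ u_θᵀ [B''(f_θ) f_θ]² dG - ξ(θ) ξ(θ)ᵀ`. -/
def K (μ : Measure 𝒳) (B : ℝ → ℝ) (f : Param s → 𝒳 → ℝ) (g : 𝒳 → ℝ) (θ : Param s) :
    Matrix (Fin s) (Fin s) ℝ :=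
  Matrix.of fun k l ↦
    (∫ x, wscore B f θ x k * wscore B f θ x l ∂(distr μ g)) - xi μ B f g θ k * xi μ B f g θ l

/-- Condition A1: the densities `f_θ` have the common support `χ`, and `G` is supported on `χ`,
where its density `g` is positive. -/
def CondA1 (μ : Measure 𝒳) (f : Param s → 𝒳 → ℝ) (g : 𝒳 → ℝ) (Ω : Set (Param s))
    (χ : Set 𝒳) : Prop :=
  (∀ θ ∈ Ω, {x | 0 < f θ x} = χ) ∧ (∀ x ∈ χ, 0 < g x) ∧ distr μ g χᶜ = 0

/-- Condition A2: `ω` is an open subset of the parameter space which contains `θg`, and for almost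
all `x` in `χ` the density is three times continuously differentiable on `ω`. -/
def CondA2 (μ : Measure 𝒳) (f : Param s → 𝒳 → ℝ) (Ω : Set (Param s)) (χ : Set 𝒳)
    (ω : Set (Param s)) (θg : Param s) : Prop :=
  IsOpen ω ∧ ω ⊆ Ω ∧ θg ∈ ω ∧ ∀ᵐ x ∂μ, x ∈ χ → ContDiffOn ℝ 3 (fun t ↦ f t x) ω

/-- Condition A3: `∫ [f_θ B'(f_θ) - B(f_θ)] dμ` and `∫ B'(f_θ) g dμ` can be differentiated three
times under the integral sign. -/
def CondA3 (μ : Measure 𝒳) (B : ℝ → ℝ) (f : Param s → 𝒳 → ℝ) (g : 𝒳 → ℝ)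
    (ω : Set (Param s)) : Prop :=
  DiffUnderIntegral μ (penalty B f) ω ∧
  DiffUnderIntegral μ (fun θ x ↦ deriv B (f θ x) * g x) ω

/-- Condition A4: `J` is positive definite (at the best fitting parameter). -/
def CondA4 (μ : Measure 𝒳) (B : ℝ → ℝ) (f : Param s → 𝒳 → ℝ) (g : 𝒳 → ℝ)
    (θg : Param s) : Prop :=
  (J μ B f g θg).PosDef

/-- Condition A5: the third partial derivatives of `V_θ(x)` are dominated on `ω` by functions of `x`
with finite expectation under `G`. -/
def CondA5 (μ : Measure 𝒳) (B : ℝ → ℝ) (f : Param s → 𝒳 → ℝ) (g : 𝒳 → ℝ)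
    (ω : Set (Param s)) : Prop :=
  ∃ M : Fin s → Fin s → Fin s → 𝒳 → ℝ, ∀ j k l,
    Integrable (M j k l) (distr μ g) ∧
    ∀ᵐ x ∂(distr μ g), ∀ θ ∈ ω, |pd j (pd k (pd l (fun t ↦ V μ B f t x))) θ| ≤ M j k l x

/-- The first `n` observations. -/
def sample {Ω' : Type*} (X : ℕ → Ω' → 𝒳) (n : ℕ) (a : Ω') : Fin n → 𝒳 := fun i ↦ X i a

/-- `θhat` is a consistent sequence of roots of the estimating equation: each `θhat n` is a statistic
of the first `n` observations, the probability that it fails to be a root in the parameter space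
tends to `0`, and it converges to `θg` in probability. -/
structure IsConsistentRootSeq {Ω' : Type*} [MeasurableSpace Ω'] (P : Measure Ω')
    (X : ℕ → Ω' → 𝒳) (μ : Measure 𝒳) (B : ℝ → ℝ) (f : Param s → 𝒳 → ℝ) (Ω : Set (Param s))
    (θg : Param s) (θhat : ∀ n : ℕ, (Fin n → 𝒳) → Param s) : Prop where
  measurable : ∀ n, Measurable (θhat n)
  root : Tendsto
    (fun n ↦ P {a | ¬ (θhat n (sample X n a) ∈ Ω ∧
      EstimatingEq μ B f (sample X n a) (θhat n (sample X n a)))}) atTop (𝓝 0)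
  consistent : TendstoInMeasure P (fun n a ↦ θhat n (sample X n a)) atTop (fun _ ↦ θg)

end Objects

end

end MinBregman

open MinBregman

/-!
The estimating equation is the critical point equation of the empirical Bregman divergence: by the
chain rule (`ae_pd_V`) its summand `drift θ - wscore θ x` is the gradient in `θ` of `V_θ(x)`.
Multiplied by `J⁻¹`, it becomes an estimating function `φ θ x` that is centred at `θ_g`, whose
derivative at `θ_g` has mean the identity, and whose linearization error on a ball of radius `ρ` is
`O(m(x) ρ)` relative to the displacement, with `m` integrable by the domination of the third
derivatives (`exists_isLocallyLinear`).

For such a function the law of large numbers shows that, with probability tending to one, the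
sample mean `Φ_n` of `φ` satisfies `‖Φ_n θ - Φ_n θ' - (θ - θ')‖ ≤ ‖θ - θ'‖ / 2` on a fixed ball and
is small at the centre. Then `θ ↦ θ - Φ_n θ` is a contraction of the ball, and its fixed point is a
root at distance at most `2 ‖Φ_n θ_g‖` from `θ_g`, which gives consistency
(`IsLocallyLinear.exists_root_seq`). Obtaining the root as the limit of the iterates, rather than by
an abstract existence theorem, is what makes it a measurable function of the sample; the iteration
is run on a jointly measurable version of `φ`, which exists because `φ` is almost surely continuous
in `θ` (`exists_measurable_uncurry_of_ae_continuous`).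

For any consistent sequence of roots the same estimate, with a relative error that now tends to
zero in probability, gives `√n (θhat - θ_g) = -√n Φ_n θ_g + o_P(1)`
(`IsLocallyLinear.tendstoInDistribution_root`). The limit law is that of the multivariate central
limit theorem for `-φ θ_g`, whose covariance matrix is `J⁻¹ K J⁻¹`
(`integral_inner_normalizedScore_sq`).
-/

namespace MinBregman

/-! ### Sample means -/

/-- The sample mean `n⁻¹ ∑ h (x i)`; it is `0` for the empty sample. -/
noncomputable def sampleMean {𝒳 F : Type*} [AddCommGroup F] [Module ℝ F] (h : 𝒳 → F) {n : ℕ}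
    (x : Fin n → 𝒳) : F :=
  (n : ℝ)⁻¹ • ∑ i, h (x i)

lemma sampleMean_sample {𝒳 Ω' F : Type*} [AddCommGroup F] [Module ℝ F] (h : 𝒳 → F)
    (X : ℕ → Ω' → 𝒳) (n : ℕ) (a : Ω') :
    sampleMean h (sample X n a) = (n : ℝ)⁻¹ • ∑ i ∈ Finset.range n, h (X i a) := by
  rw [sampleMean, ← Fin.sum_univ_eq_sum_range (fun i ↦ h (X i a))]
  rfl

section LimitTheorems

variable {𝒳 Ω' : Type*} [MeasurableSpace 𝒳] [MeasurableSpace Ω'] {P : Measure Ω'}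
  {ν : Measure 𝒳} {X : ℕ → Ω' → 𝒳}

lemma aemeasurable_sample (hX : ∀ i, HasLaw (X i) ν P) (n : ℕ) :
    AEMeasurable (sample X n) P :=
  aemeasurable_pi_lambda _ fun i ↦ (hX i).aemeasurable

lemma aestronglyMeasurable_comp_law {F : Type*} [TopologicalSpace F] {h : 𝒳 → F}
    (hX : ∀ i, HasLaw (X i) ν P) (hh : AEStronglyMeasurable h ν) (i : ℕ) :
    AEStronglyMeasurable (fun a ↦ h (X i a)) P :=
  ((hX i).map_eq.symm ▸ hh).comp_aemeasurable (hX i).aemeasurable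

lemma aestronglyMeasurable_sampleMean {F : Type*} [NormedAddCommGroup F] [NormedSpace ℝ F]
    {h : 𝒳 → F} (hX : ∀ i, HasLaw (X i) ν P) (hh : AEStronglyMeasurable h ν) (n : ℕ) :
    AEStronglyMeasurable (fun a ↦ sampleMean h (sample X n a)) P := by
  simp_rw [sampleMean_sample]
  exact (Finset.aestronglyMeasurable_fun_sum _ fun i _ ↦
    aestronglyMeasurable_comp_law hX hh i).const_smul _

lemma ae_forall_law {p : 𝒳 → Prop} (hX : ∀ i, HasLaw (X i) ν P) (hp : ∀ᵐ x ∂ν, p x) :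
    ∀ᵐ a ∂P, ∀ i, p (X i a) :=
  ae_all_iff.2 fun i ↦ ae_of_ae_map (hX i).aemeasurable ((hX i).map_eq.symm ▸ hp)

lemma identDistrib_law {F : Type*} [MeasurableSpace F] {h : 𝒳 → F}
    (hX : ∀ i, HasLaw (X i) ν P) (hh : AEMeasurable h ν) (i : ℕ) :
    IdentDistrib (fun a ↦ h (X i a)) (fun a ↦ h (X 0 a)) P P :=
  IdentDistrib.comp_of_aemeasurable (f := X i) (g := X 0) (u := h)
    ⟨(hX i).aemeasurable, (hX 0).aemeasurable, (hX i).map_eq.trans (hX 0).map_eq.symm⟩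
    ((hX i).map_eq.symm ▸ hh)

lemma iIndepFun_comp_law {F : Type*} [MeasurableSpace F] {h : 𝒳 → F}
    (hX : ∀ i, HasLaw (X i) ν P) (hind : iIndepFun X P) (hh : AEMeasurable h ν) :
    iIndepFun (fun i a ↦ h (X i a)) P :=
  hind.comp₀ (fun _ ↦ h) (fun i ↦ (hX i).aemeasurable) fun i ↦ (hX i).map_eq.symm ▸ hh

lemma integral_comp_law {F : Type*} [NormedAddCommGroup F] [NormedSpace ℝ F]
    {h : 𝒳 → F} (hX : ∀ i, HasLaw (X i) ν P) (hh : AEStronglyMeasurable h ν) (i : ℕ) :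
    ∫ a, h (X i a) ∂P = ∫ x, h x ∂ν := by
  rw [← (hX i).map_eq, integral_map (hX i).aemeasurable ((hX i).map_eq.symm ▸ hh)]

/-- The weak law of large numbers for `h (X i)`, with values in a Banach space. -/
lemma tendstoInMeasure_sampleMean [IsProbabilityMeasure P] {F : Type*} [NormedAddCommGroup F]
    [NormedSpace ℝ F] [CompleteSpace F] {h : 𝒳 → F} (hX : ∀ i, HasLaw (X i) ν P)
    (hind : iIndepFun X P) (hh : Integrable h ν) :
    TendstoInMeasure P (fun n a ↦ sampleMean h (sample X n a)) atTop (fun _ ↦ ∫ x, h x ∂ν) := by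
  borelize F
  refine tendstoInMeasure_of_tendsto_ae
    (fun n ↦ aestronglyMeasurable_sampleMean hX hh.aestronglyMeasurable n) ?_
  have hm := hh.aestronglyMeasurable.aemeasurable
  have hint : Integrable (fun a ↦ h (X 0 a)) P :=
    ((hX 0).map_eq.symm ▸ hh : Integrable h (P.map (X 0))).comp_aemeasurable (hX 0).aemeasurable
  have := strong_law_ae (fun i a ↦ h (X i a)) hint
    (fun i j hij ↦ (iIndepFun_comp_law hX hind hm).indepFun hij) (identDistrib_law hX hm)
  rw [integral_comp_law hX hh.aestronglyMeasurable] at this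
  simpa only [sampleMean_sample] using this

lemma tendsto_measure_le_norm_sampleMean_sub [IsProbabilityMeasure P] {F : Type*}
    [NormedAddCommGroup F] [NormedSpace ℝ F] [CompleteSpace F] {h : 𝒳 → F}
    (hX : ∀ i, HasLaw (X i) ν P) (hind : iIndepFun X P) (hh : Integrable h ν) {ε : ℝ}
    (hε : 0 < ε) :
    Tendsto (fun n ↦ P {a | ε ≤ ‖sampleMean h (sample X n a) - ∫ x, h x ∂ν‖}) atTop (𝓝 0) := by
  have := tendstoInMeasure_sampleMean hX hind hh
  rw [tendstoInMeasure_iff_norm] at this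
  exact this ε hε

/-- The multivariate central limit theorem for the centred variables `h (X i)`, from the real one
applied to `⟪h (X i), t⟫` and Lévy's continuity theorem. -/
lemma tendstoInDistribution_inv_sqrt_smul_sum [IsProbabilityMeasure P] {s : ℕ} {h : 𝒳 → Param s}
    (hX : ∀ i, HasLaw (X i) ν P) (hind : iIndepFun X P) (hh : MemLp h 2 ν)
    (h0 : ∫ x, h x ∂ν = 0) {S : Matrix (Fin s) (Fin s) ℝ} (hS : S.PosSemidef)
    (hcov : ∀ t : Param s, ∫ x, inner ℝ t (h x) ^ 2 ∂ν = t.ofLp ⬝ᵥ S.mulVec t.ofLp) :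
    TendstoInDistribution
      (fun (n : ℕ) a ↦ (√(n : ℝ))⁻¹ • ∑ i ∈ Finset.range n, h (X i a)) atTop
      (id : Param s → Param s) (fun _ ↦ P) (multivariateGaussian 0 S) := by
  have hmeas := hh.aestronglyMeasurable
  have : IsProbabilityMeasure ν := (hX 0).map_eq ▸ Measure.isProbabilityMeasure_map
    (hX 0).aemeasurable
  have hsum (n : ℕ) : AEMeasurable (fun a ↦ (√(n : ℝ))⁻¹ • ∑ i ∈ Finset.range n, h (X i a)) P :=
    AEMeasurable.fun_const_smul (Finset.aemeasurable_fun_sum _ fun i _ ↦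
      (aestronglyMeasurable_comp_law hX hmeas i).aemeasurable) _
  refine ⟨hsum, aemeasurable_id, ?_⟩
  refine ProbabilityMeasure.tendsto_iff_tendsto_charFun.2 fun t ↦ ?_
  have ht : MemLp (fun x ↦ inner ℝ t (h x)) 2 ν := hh.const_inner t
  have ht0 : ∫ x, inner ℝ t (h x) ∂ν = 0 := by
    rw [integral_inner (hh.integrable (by norm_num)), h0, inner_zero_right]
  have hmap : MemLp (fun a ↦ inner ℝ t (h (X 0 a))) 2 P :=
    ((hX 0).map_eq.symm ▸ ht : MemLp (fun x ↦ inner ℝ t (h x)) 2 (P.map (X 0))).comp_of_map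
      (hX 0).aemeasurable
  have hvar : Var[fun a ↦ inner ℝ t (h (X 0 a)); P] = t.ofLp ⬝ᵥ S.mulVec t.ofLp := by
    rw [variance_of_integral_eq_zero hmap.aestronglyMeasurable.aemeasurable
      ((integral_comp_law (h := fun x ↦ inner ℝ t (h x)) hX ht.aestronglyMeasurable 0).trans ht0),
      ← hcov]
    exact integral_comp_law (h := fun x ↦ inner ℝ t (h x) ^ 2) hX
      (ht.aestronglyMeasurable.pow 2) 0
  have clt := tendstoInDistribution_inv_sqrt_mul_sum_sub
    (X := fun i a ↦ inner ℝ t (h (X i a))) (P := P) (Y := (id : ℝ → ℝ))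
    (P' := gaussianReal 0 Var[fun a ↦ inner ℝ t (h (X 0 a)); P].toNNReal)
    ⟨aemeasurable_id, Measure.map_id⟩ hmap
    (iIndepFun_comp_law (h := fun x ↦ inner ℝ t (h x)) hX hind ht.aestronglyMeasurable.aemeasurable)
    (identDistrib_law (h := fun x ↦ inner ℝ t (h x)) hX ht.aestronglyMeasurable.aemeasurable)
  have hlim := ProbabilityMeasure.tendsto_iff_tendsto_charFun.1 clt.tendsto 1
  have hz : ∫ a, inner ℝ t (h (X 0 a)) ∂P = 0 :=
    (integral_comp_law (h := fun x ↦ inner ℝ t (h x)) hX ht.aestronglyMeasurable 0).trans ht0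
  have hnn : 0 ≤ t.ofLp ⬝ᵥ S.mulVec t.ofLp := by
    rw [← hcov]; exact integral_nonneg fun _ ↦ sq_nonneg _
  simp only [ProbabilityMeasure.coe_mk, Measure.map_id, charFun_gaussianReal, hvar, hz] at hlim
  simp only [ProbabilityMeasure.coe_mk, Measure.map_id, charFun_multivariateGaussian hS]
  convert hlim using 1
  · ext n
    rw [charFun_apply, charFun_apply, integral_map (hsum n) (by fun_prop), integral_map _
      (by fun_prop)]
    · congr 1
      ext a
      simp [real_inner_comm, inner_smul_left, sum_inner]
    · exact ((Finset.aemeasurable_fun_sum _ fun i _ ↦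
        (aestronglyMeasurable_comp_law (h := fun x ↦ inner ℝ t (h x)) hX
          ht.aestronglyMeasurable i).aemeasurable).sub_const _).const_mul _
  · simp [Real.coe_toNNReal _ hnn]

end LimitTheorems

/-! ### Convergence in probability -/

section InMeasure

variable {Ω' E : Type*} [MeasurableSpace Ω'] {P : Measure Ω'}

/-- A family of events is asymptotically negligible if it is almost surely covered by two
asymptotically negligible families. -/
lemma tendsto_measure_zero_of_ae_imp {A A₁ A₂ : ℕ → Set Ω'}
    (h₁ : Tendsto (fun n ↦ P (A₁ n)) atTop (𝓝 0)) (h₂ : Tendsto (fun n ↦ P (A₂ n)) atTop (𝓝 0))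
    (h : ∀ᶠ n in atTop, ∀ᵐ a ∂P, a ∈ A n → a ∈ A₁ n ∨ a ∈ A₂ n) :
    Tendsto (fun n ↦ P (A n)) atTop (𝓝 0) := by
  refine tendsto_of_tendsto_of_tendsto_of_le_of_le' tendsto_const_nhds
    (by simpa using h₁.add h₂) (.of_forall fun _ ↦ zero_le) ?_
  filter_upwards [h] with n hn
  exact (measure_mono_ae hn).trans (measure_union_le _ _)

lemma tendstoInMeasure_zero_of_tendstoInDistribution [NormedAddCommGroup E] [MeasurableSpace E]
    [BorelSpace E] [IsProbabilityMeasure P] {Ω'' : Type*} [MeasurableSpace Ω'']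
    {P' : Measure Ω''} [IsProbabilityMeasure P'] {Y : ℕ → Ω' → E}
    (h : TendstoInDistribution Y atTop (fun _ : Ω'' ↦ (0 : E)) (fun _ ↦ P) P') :
    TendstoInMeasure P Y atTop (fun _ ↦ 0) := by
  rw [tendstoInMeasure_iff_norm]
  intro ε hε
  have hF : IsClosed {y : E | ε ≤ ‖y‖} := isClosed_le continuous_const continuous_norm
  have := ProbabilityMeasure.limsup_measure_closed_le_of_tendsto h.tendsto hF
  simp only [ProbabilityMeasure.coe_mk] at this
  rw [Measure.map_apply_of_aemeasurable aemeasurable_const hF.measurableSet] at this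
  simp only [Set.preimage_ofPred_eq, norm_zero, hε.not_ge, Set.ofPred_false, measure_empty] at this
  refine tendsto_of_le_liminf_of_limsup_le zero_le (le_trans (le_of_eq ?_) this)
  congr 1
  ext n
  rw [Measure.map_apply_of_aemeasurable (h.forall_aemeasurable n) hF.measurableSet]
  simp

/-- A sequence which is negligible relative to a sequence that converges in distribution tends to
zero in probability. -/
lemma tendstoInMeasure_smul_of_tendstoInDistribution [NormedAddCommGroup E] [NormedSpace ℝ E]
    [SecondCountableTopology E] [MeasurableSpace E]
    [BorelSpace E] [IsProbabilityMeasure P] {Ω'' : Type*} [MeasurableSpace Ω'']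
    {P' : Measure Ω''} [IsProbabilityMeasure P'] {S : ℕ → Ω' → E} {Z : Ω'' → E} {R : ℕ → Ω' → ℝ}
    (hS : TendstoInDistribution S atTop Z (fun _ ↦ P) P')
    (hR : TendstoInMeasure P R atTop (fun _ ↦ 0)) (hRm : ∀ n, AEMeasurable (R n) P) :
    TendstoInMeasure P (fun n a ↦ R n a • S n a) atTop (fun _ ↦ 0) := by
  refine tendstoInMeasure_zero_of_tendstoInDistribution (P' := P') ?_
  simpa using hS.continuous_comp_prodMk_of_tendstoInMeasure_const
    (g := fun p : E × ℝ ↦ p.2 • p.1) (by fun_prop) hR hRm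

end InMeasure

/-! ### A measurable root from the Newton iteration -/

section Newton

variable {E : Type*} [NormedAddCommGroup E]

/-- If `Φ - id` has Lipschitz constant `1/2` on a closed ball and `Φ` is small at the centre, then
the simplified Newton iteration `θ ↦ θ - Φ θ` converges to a root. -/
lemma exists_root_of_near_id [CompleteSpace E] {Φ T : E → E} {θ₀ : E} {ρ : ℝ}
    (hΦ : ∀ θ ∈ Metric.closedBall θ₀ ρ, ∀ θ' ∈ Metric.closedBall θ₀ ρ,
      ‖Φ θ - Φ θ' - (θ - θ')‖ ≤ 1 / 2 * ‖θ - θ'‖)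
    (h0 : ‖Φ θ₀‖ ≤ ρ / 2) (hT : ∀ θ ∈ Metric.closedBall θ₀ ρ, T θ = θ - Φ θ) :
    ∃ y ∈ Metric.closedBall θ₀ ρ, Φ y = 0 ∧ Tendsto (fun k ↦ T^[k] θ₀) atTop (𝓝 y) ∧
      ‖y - θ₀‖ ≤ 2 * ‖Φ θ₀‖ := by
  have hρ : 0 ≤ ρ := by linarith [norm_nonneg (Φ θ₀)]
  have hc : θ₀ ∈ Metric.closedBall θ₀ ρ := Metric.mem_closedBall_self hρ
  have hlip : ∀ θ ∈ Metric.closedBall θ₀ ρ, ∀ θ' ∈ Metric.closedBall θ₀ ρ,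
      ‖T θ - T θ'‖ ≤ 1 / 2 * ‖θ - θ'‖ := by
    intro θ hθ θ' hθ'
    rw [hT θ hθ, hT θ' hθ', ← norm_neg, show -(θ - Φ θ - (θ' - Φ θ')) = Φ θ - Φ θ' - (θ - θ') by
      abel]
    exact hΦ θ hθ θ' hθ'
  have hT0 : ‖T θ₀ - θ₀‖ = ‖Φ θ₀‖ := by rw [hT _ hc, sub_sub_cancel_left, norm_neg]
  have hmaps : Set.MapsTo T (Metric.closedBall θ₀ ρ) (Metric.closedBall θ₀ ρ) := by
    intro θ hθ
    have h1 := hlip θ hθ θ₀ hc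
    have h2 : ‖θ - θ₀‖ ≤ ρ := by simpa [dist_eq_norm] using hθ
    rw [Metric.mem_closedBall, dist_eq_norm]
    calc ‖T θ - θ₀‖ ≤ ‖T θ - T θ₀‖ + ‖T θ₀ - θ₀‖ := norm_sub_le_norm_sub_add_norm_sub _ _ _
      _ ≤ ρ := by rw [hT0]; linarith
  have hcontr : ContractingWith (1 / 2) (hmaps.restrict T _ _) := by
    refine ⟨by norm_num, LipschitzWith.of_dist_le_mul fun x y ↦ ?_⟩
    have := hlip x x.2 y y.2
    simpa [Subtype.dist_eq, dist_eq_norm] using this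
  obtain ⟨y, hy, hfix, hlim, -⟩ := hcontr.exists_fixedPoint' Metric.isClosed_closedBall.isComplete
    hmaps hc (edist_ne_top _ _)
  have hfix' : T y = y := hfix
  refine ⟨y, hy, ?_, hlim, ?_⟩
  · have := hT y hy
    rw [hfix'] at this
    exact sub_eq_self.1 this.symm
  · have h1 := hlip y hy θ₀ hc
    have h2 : ‖T y - θ₀‖ ≤ ‖T y - T θ₀‖ + ‖T θ₀ - θ₀‖ := norm_sub_le_norm_sub_add_norm_sub _ _ _
    rw [hfix'] at h1 h2
    rw [hT0] at h2
    linarith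

/-- A continuous retraction onto the closed ball of centre `c` and radius `ρ > 0`. -/
noncomputable def clamp [NormedSpace ℝ E] (c : E) (ρ : ℝ) (θ : E) : E :=
  c + (ρ / max ρ ‖θ - c‖) • (θ - c)

variable [NormedSpace ℝ E] {c : E} {ρ : ℝ}

lemma continuous_clamp (hρ : 0 < ρ) : Continuous (clamp c ρ) := by
  have (θ : E) : max ρ ‖θ - c‖ ≠ 0 := (lt_max_of_lt_left hρ).ne'
  unfold clamp
  fun_prop (disch := exact this _)

lemma clamp_mem (hρ : 0 < ρ) (θ : E) : clamp c ρ θ ∈ Metric.closedBall c ρ := by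
  have h : 0 < max ρ ‖θ - c‖ := lt_max_of_lt_left hρ
  rw [Metric.mem_closedBall, dist_eq_norm, clamp, add_sub_cancel_left, norm_smul,
    Real.norm_of_nonneg (by positivity), div_mul_eq_mul_div, div_le_iff₀ h]
  gcongr
  exact le_max_right _ _

lemma clamp_of_mem (hρ : 0 < ρ) {θ : E} (hθ : θ ∈ Metric.closedBall c ρ) : clamp c ρ θ = θ := by
  rw [Metric.mem_closedBall, dist_eq_norm] at hθ
  rw [clamp, max_eq_left hθ, div_self hρ.ne', one_smul, add_sub_cancel]

/-- A random function which is almost surely continuous agrees, almost surely and at all points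
simultaneously, with a jointly measurable one. -/
lemma exists_measurable_uncurry_of_ae_continuous {𝒳 G F : Type*} [MeasurableSpace 𝒳]
    {ν : Measure 𝒳} [TopologicalSpace G] [TopologicalSpace.MetrizableSpace G]
    [SecondCountableTopology G] [MeasurableSpace G] [BorelSpace G]
    [NormedAddCommGroup F] [MeasurableSpace F] [BorelSpace F] {u : G → 𝒳 → F}
    (hcont : ∀ᵐ x ∂ν, Continuous fun θ ↦ u θ x) (hmeas : ∀ θ, AEMeasurable (u θ) ν) :
    ∃ v : G → 𝒳 → F, Measurable (Function.uncurry v) ∧ ∀ᵐ x ∂ν, ∀ θ, v θ x = u θ x := by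
  obtain ⟨D, hDc, hDd⟩ := TopologicalSpace.exists_countable_dense G
  have hD : ∀ᵐ x ∂ν, ∀ θ ∈ D, u θ x = (hmeas θ).mk _ x :=
    (ae_ball_iff hDc).2 fun θ _ ↦ (hmeas θ).ae_eq_mk
  obtain ⟨N, hN, hNm, hN0⟩ := exists_measurable_superset_of_null (hcont.and hD)
  have hgood : ∀ x ∉ N, (Continuous fun θ ↦ u θ x) ∧ ∀ θ ∈ D, u θ x = (hmeas θ).mk _ x := by
    intro x hx
    by_contra h
    exact hx (hN h)
  refine ⟨fun θ ↦ Nᶜ.indicator (u θ), ?_, ?_⟩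
  · refine measurable_uncurry_of_continuous_of_measurable (fun x ↦ ?_) fun θ ↦ ?_
    · by_cases hx : x ∈ N
      · simpa [hx] using continuous_const
      · simpa [hx] using (hgood x hx).1
    · let := TopologicalSpace.metrizableSpaceMetric G
      obtain ⟨d, hd, hlim⟩ := mem_closure_iff_seq_limit.1 (hDd θ)
      refine measurable_of_tendsto_metrizable
        (f := fun k ↦ Nᶜ.indicator ((hmeas (d k)).mk _))
        (fun k ↦ (hmeas (d k)).measurable_mk.indicator hNm.compl) ?_
      refine tendsto_pi_nhds.2 fun x ↦ ?_
      by_cases hx : x ∈ N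
      · simp [hx]
      · have := ((hgood x hx).1.tendsto θ).comp hlim
        simp only [Set.indicator_of_mem (Set.mem_compl hx)]
        refine this.congr fun k ↦ ?_
        exact (hgood x hx).2 _ (hd k)
  · filter_upwards [compl_mem_ae_iff.2 hN0] with x hx θ
    exact Set.indicator_of_mem hx _

end Newton

/-! ### Roots of locally linear random equations -/

section ZEstimation

/-- The linearization of the summands passes to the sample means. -/
lemma norm_sampleMean_sub_le {E 𝒳 : Type*} [NormedAddCommGroup E] [NormedSpace ℝ E]
    {φ : E → 𝒳 → E} {θ₀ : E} {r : ℝ} {L : 𝒳 → E →L[ℝ] E} {m : 𝒳 → ℝ}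
    {n : ℕ} {x : Fin n → 𝒳}
    (hx : ∀ i, ∀ ρ ≤ r, ∀ θ ∈ Metric.closedBall θ₀ ρ, ∀ θ' ∈ Metric.closedBall θ₀ ρ,
      ‖φ θ (x i) - φ θ' (x i) - L (x i) (θ - θ')‖ ≤ m (x i) * ρ * ‖θ - θ'‖)
    {ρ : ℝ} (hρ : ρ ≤ r) {θ θ' : E} (hθ : θ ∈ Metric.closedBall θ₀ ρ)
    (hθ' : θ' ∈ Metric.closedBall θ₀ ρ) :
    ‖sampleMean (φ θ) x - sampleMean (φ θ') x - (θ - θ')‖ ≤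
      (‖sampleMean L x - ContinuousLinearMap.id ℝ E‖ + ρ * sampleMean m x) * ‖θ - θ'‖ := by
  have h1 : sampleMean (φ θ) x - sampleMean (φ θ') x - (θ - θ') =
      (n : ℝ)⁻¹ • ∑ i, (φ θ (x i) - φ θ' (x i) - L (x i) (θ - θ')) +
        (sampleMean L x - ContinuousLinearMap.id ℝ E) (θ - θ') := by
    simp only [sampleMean, Finset.sum_sub_distrib, smul_sub, sub_apply, smul_apply, sum_apply,
      ContinuousLinearMap.id_apply]
    abel
  rw [h1, add_comm, add_mul]
  refine (norm_add_le _ _).trans (add_le_add (ContinuousLinearMap.le_opNorm _ _) ?_)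
  rw [norm_smul, Real.norm_of_nonneg (by positivity), sampleMean, smul_eq_mul]
  calc (n : ℝ)⁻¹ * ‖∑ i, (φ θ (x i) - φ θ' (x i) - L (x i) (θ - θ'))‖
      ≤ (n : ℝ)⁻¹ * ∑ i, m (x i) * ρ * ‖θ - θ'‖ := by
        gcongr
        exact norm_sum_le_of_le _ fun i _ ↦ hx i ρ hρ θ hθ θ' hθ'
    _ = _ := by rw [← Finset.sum_mul, ← Finset.sum_mul]; ring

variable {E 𝒳 Ω' : Type*} [NormedAddCommGroup E] [NormedSpace ℝ E]
  [MeasurableSpace 𝒳] [MeasurableSpace Ω']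

/-- The estimating function `φ θ x` is centred at `θ₀` under the law `ν`, and on the closed ball of
radius `r` about `θ₀` it is linear in `θ`, up to an error which is of second order with an
integrable constant `m x`. The derivatives `L x` are normalized to have mean the identity. -/
structure IsLocallyLinear (ν : Measure 𝒳) (φ : E → 𝒳 → E) (θ₀ : E) (r : ℝ) (L : 𝒳 → E →L[ℝ] E)
    (m : 𝒳 → ℝ) : Prop where
  pos : 0 < r
  aestronglyMeasurable : ∀ θ ∈ Metric.closedBall θ₀ r, AEStronglyMeasurable (φ θ) ν
  integrable_center : Integrable (φ θ₀) ν
  integral_center : ∫ x, φ θ₀ x ∂ν = 0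
  integrable_deriv : Integrable L ν
  integral_deriv : ∫ x, L x ∂ν = ContinuousLinearMap.id ℝ E
  nonneg : ∀ x, 0 ≤ m x
  integrable_bound : Integrable m ν
  approx : ∀ᵐ x ∂ν, ∀ ρ ≤ r, ∀ θ ∈ Metric.closedBall θ₀ ρ, ∀ θ' ∈ Metric.closedBall θ₀ ρ,
    ‖φ θ x - φ θ' x - L x (θ - θ')‖ ≤ m x * ρ * ‖θ - θ'‖

variable {ν : Measure 𝒳} {P : Measure Ω'} [IsProbabilityMeasure P] {X : ℕ → Ω' → 𝒳}
  {φ : E → 𝒳 → E} {θ₀ : E} {r : ℝ} {L : 𝒳 → E →L[ℝ] E} {m : 𝒳 → ℝ}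

/-- The laws of large numbers behind the local analysis, in the form of a vanishing probability. -/
lemma IsLocallyLinear.tendsto_measure_bad [CompleteSpace E] (h : IsLocallyLinear ν φ θ₀ r L m)
    (hX : ∀ i, HasLaw (X i) ν P) (hind : iIndepFun X P) {ε δ : ℝ} (hε : 0 < ε) (hδ : 0 < δ) :
    Tendsto (fun n ↦ P {a | ¬ (‖sampleMean (φ θ₀) (sample X n a)‖ < ε ∧
      ‖sampleMean L (sample X n a) - ContinuousLinearMap.id ℝ E‖ < δ ∧
      sampleMean m (sample X n a) < ∫ x, m x ∂ν + 1)}) atTop (𝓝 0) := by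
  have h1 := tendsto_measure_le_norm_sampleMean_sub hX hind h.integrable_center hε
  have h2 := tendsto_measure_le_norm_sampleMean_sub hX hind h.integrable_deriv hδ
  have h3 := tendsto_measure_le_norm_sampleMean_sub hX hind h.integrable_bound one_pos
  simp only [h.integral_center, h.integral_deriv, sub_zero] at h1 h2
  have h23 := tendsto_measure_zero_of_ae_imp (A := fun n ↦
    {a | ¬ (‖sampleMean L (sample X n a) - ContinuousLinearMap.id ℝ E‖ < δ ∧
      sampleMean m (sample X n a) < ∫ x, m x ∂ν + 1)}) h2 h3 (.of_forall fun n ↦ ae_of_all _ ?_)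
  · refine tendsto_measure_zero_of_ae_imp h1 h23 (.of_forall fun n ↦ ae_of_all _ fun a ha ↦ ?_)
    simp only [Set.mem_ofPred_eq] at ha ⊢
    by_contra! hcon
    exact ha ⟨hcon.1, hcon.2⟩
  · intro a ha
    simp only [Set.mem_ofPred_eq] at ha ⊢
    by_contra! hcon
    refine ha ⟨hcon.1, ?_⟩
    have := (le_abs_self _).trans_lt hcon.2
    linarith

variable [FiniteDimensional ℝ E] [MeasurableSpace E] [BorelSpace E]

/-- A locally linear estimating equation has measurable roots which are consistent. -/
theorem IsLocallyLinear.exists_root_seq (h : IsLocallyLinear ν φ θ₀ r L m)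
    (hX : ∀ i, HasLaw (X i) ν P) (hind : iIndepFun X P) :
    ∃ θhat : ∀ n : ℕ, (Fin n → 𝒳) → E, (∀ n, Measurable (θhat n)) ∧
      Tendsto (fun n ↦ P {a | ¬ (θhat n (sample X n a) ∈ Metric.closedBall θ₀ r ∧
        sampleMean (φ (θhat n (sample X n a))) (sample X n a) = 0)}) atTop (𝓝 0) ∧
      TendstoInMeasure P (fun n a ↦ θhat n (sample X n a)) atTop (fun _ ↦ θ₀) := by
  have : CompleteSpace E := FiniteDimensional.complete ℝ E
  have : ProperSpace E := FiniteDimensional.proper_real E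
  set C := ∫ x, m x ∂ν + 1
  have hCpos : 0 < C := by
    have : 0 ≤ ∫ x, m x ∂ν := integral_nonneg h.nonneg
    positivity
  -- on the ball of radius `ρ` the perturbation has Lipschitz constant at most `1/4 + ρ C ≤ 1/2`
  set ρ := min r (1 / (4 * C))
  have hρ : 0 < ρ := lt_min h.pos (by positivity)
  have hρC : ρ * C ≤ 1 / 4 := by
    calc ρ * C ≤ 1 / (4 * C) * C := by gcongr; exact min_le_right _ _
      _ = 1 / 4 := by field_simp
  have hρr : ρ ≤ r := min_le_left _ _
  have hsub := Metric.closedBall_subset_closedBall (x := θ₀) hρr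
  obtain ⟨v, hv, hvφ⟩ := exists_measurable_uncurry_of_ae_continuous (ν := ν)
    (u := fun θ ↦ φ (clamp θ₀ ρ θ)) (by
      filter_upwards [h.approx] with x hx
      refine ContinuousOn.comp_continuous (s := Metric.closedBall θ₀ ρ)
        (g := fun θ ↦ φ θ x) ?_ (continuous_clamp hρ) (clamp_mem hρ)
      refine LipschitzOnWith.continuousOn
        (K := (m x * ρ + ‖L x‖).toNNReal) (LipschitzOnWith.of_dist_le_mul fun θ hθ θ' hθ' ↦ ?_)
      have h1 := hx ρ hρr θ hθ θ' hθ'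
      have h2 := (L x).le_opNorm (θ - θ')
      have h3 := norm_add_le (φ θ x - φ θ' x - L x (θ - θ')) (L x (θ - θ'))
      rw [sub_add_cancel] at h3
      have h4 := h.nonneg x
      rw [dist_eq_norm, dist_eq_norm, Real.coe_toNNReal _ (by positivity)]
      linarith)
    (fun θ ↦ (h.aestronglyMeasurable _ (hsub (clamp_mem hρ θ))).aemeasurable)
  let T (n : ℕ) (x : Fin n → 𝒳) (θ : E) : E := clamp θ₀ ρ θ - sampleMean (v θ) x
  have hT (n : ℕ) : Measurable fun p : (Fin n → 𝒳) × E ↦ T n p.1 p.2 := by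
    have hv' (i : Fin n) : Measurable fun p : (Fin n → 𝒳) × E ↦ v p.2 (p.1 i) :=
      hv.comp (f := fun p : (Fin n → 𝒳) × E ↦ (p.2, p.1 i)) (by fun_prop)
    have h1 : Measurable (clamp θ₀ ρ) := (continuous_clamp hρ).measurable
    refine (h1.comp measurable_snd).sub ?_
    exact (Finset.measurable_fun_sum _ fun i _ ↦ hv' i).const_smul ((n : ℝ)⁻¹)
  have hTk (n k : ℕ) : Measurable fun x ↦ (T n x)^[k] θ₀ := by
    induction k with
    | zero => exact measurable_const
    | succ k ih =>
      simp only [Function.iterate_succ_apply']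
      exact (hT n).comp (measurable_id.prodMk ih)
  -- where all the regularity holds, the limit of the Newton iteration is a root close to `θ₀`
  have key : ∀ n, ∀ᵐ a ∂P, ‖sampleMean (φ θ₀) (sample X n a)‖ < ρ / 2 ∧
      ‖sampleMean L (sample X n a) - ContinuousLinearMap.id ℝ E‖ < 1 / 4 ∧
      sampleMean m (sample X n a) < C →
      ∃ y ∈ Metric.closedBall θ₀ ρ, sampleMean (φ y) (sample X n a) = 0 ∧
        limUnder atTop (fun k ↦ (T n (sample X n a))^[k] θ₀) = y ∧
        ‖y - θ₀‖ ≤ 2 * ‖sampleMean (φ θ₀) (sample X n a)‖ := by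
    intro n
    filter_upwards [ae_forall_law hX h.approx, ae_forall_law hX hvφ] with a ha1 ha2 ⟨h0, hL, hm⟩
    have hle : ‖sampleMean L (sample X n a) - ContinuousLinearMap.id ℝ E‖ +
        ρ * sampleMean m (sample X n a) ≤ 1 / 2 := by
      have : ρ * sampleMean m (sample X n a) ≤ ρ * C := by gcongr
      linarith
    obtain ⟨y, hy, hy0, hlim, hyle⟩ := exists_root_of_near_id
      (Φ := fun θ ↦ sampleMean (φ θ) (sample X n a)) (T := T n (sample X n a)) (θ₀ := θ₀) (ρ := ρ)
      (fun θ hθ θ' hθ' ↦ (norm_sampleMean_sub_le (fun i ↦ ha1 i) hρr hθ hθ').trans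
        (mul_le_mul_of_nonneg_right hle (norm_nonneg _))) h0.le (fun θ hθ ↦ by
          simp only [T, sampleMean, sample, ha2, clamp_of_mem hρ hθ])
    exact ⟨y, hy, hy0, hlim.limUnder_eq, hyle⟩
  refine ⟨fun n x ↦ limUnder atTop fun k ↦ (T n x)^[k] θ₀, fun n ↦ ?_, ?_, ?_⟩
  · exact (StronglyMeasurable.limUnder fun k ↦ (hTk n k).stronglyMeasurable).measurable
  · have hbad := h.tendsto_measure_bad hX hind (half_pos hρ) (show (0 : ℝ) < 1 / 4 by norm_num)
    refine tendsto_measure_zero_of_ae_imp hbad hbad (.of_forall fun n ↦ ?_)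
    filter_upwards [key n] with a ha hna
    refine Or.inl fun hgood ↦ hna ?_
    obtain ⟨y, hy, hy0, hlim, -⟩ := ha hgood
    rw [hlim]
    exact ⟨hsub hy, hy0⟩
  · rw [tendstoInMeasure_iff_norm]
    intro ε hε
    have hbad := h.tendsto_measure_bad hX hind (ε := min (ρ / 2) (ε / 2)) (by positivity)
      (show (0 : ℝ) < 1 / 4 by norm_num)
    refine tendsto_measure_zero_of_ae_imp hbad hbad (.of_forall fun n ↦ ?_)
    filter_upwards [key n] with a ha hna
    refine Or.inl fun hgood ↦ ?_
    obtain ⟨y, hy, hy0, hlim, hle⟩ :=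
      ha ⟨hgood.1.trans_le (min_le_left _ _), hgood.2.1, hgood.2.2⟩
    simp only [hlim] at hna
    have := hgood.1.trans_le (min_le_right _ _)
    linarith

/-- Consistent roots of a locally linear estimating equation differ from minus the sample mean at
`θ₀` by an error which is negligible after scaling with `√n`, hence have the same limit law. -/
theorem IsLocallyLinear.tendstoInDistribution_root (h : IsLocallyLinear ν φ θ₀ r L m)
    (hX : ∀ i, HasLaw (X i) ν P) (hind : iIndepFun X P)
    {Ω'' : Type*} [MeasurableSpace Ω''] {P' : Measure Ω''} [IsProbabilityMeasure P'] {Z : Ω'' → E}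
    (hclt : TendstoInDistribution
      (fun (n : ℕ) a ↦ (√(n : ℝ))⁻¹ • ∑ i ∈ Finset.range n, -φ θ₀ (X i a)) atTop Z (fun _ ↦ P) P')
    {θhat : ∀ n : ℕ, (Fin n → 𝒳) → E} (hmeas : ∀ n, Measurable (θhat n))
    (hroot : Tendsto (fun n ↦ P {a | sampleMean (φ (θhat n (sample X n a))) (sample X n a) ≠ 0})
      atTop (𝓝 0))
    (hcons : TendstoInMeasure P (fun n a ↦ θhat n (sample X n a)) atTop (fun _ ↦ θ₀)) :
    TendstoInDistribution (fun (n : ℕ) a ↦ √(n : ℝ) • (θhat n (sample X n a) - θ₀)) atTop Z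
      (fun _ ↦ P) P' := by
  have : CompleteSpace E := FiniteDimensional.complete ℝ E
  have : ProperSpace E := FiniteDimensional.proper_real E
  set C := ∫ x, m x ∂ν + 1
  have hCpos : 0 < C := by
    have : 0 ≤ ∫ x, m x ∂ν := integral_nonneg h.nonneg
    positivity
  have hθm (n : ℕ) : AEMeasurable (fun a ↦ θhat n (sample X n a)) P :=
    (hmeas n).comp_aemeasurable (aemeasurable_sample hX n)
  -- the relative error of the linearization at the root
  let R (n : ℕ) (a : Ω') : ℝ := 2 * (‖sampleMean L (sample X n a) - ContinuousLinearMap.id ℝ E‖ +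
    C * ‖θhat n (sample X n a) - θ₀‖)
  have hLm (n : ℕ) := aestronglyMeasurable_sampleMean hX h.integrable_deriv.aestronglyMeasurable n
  have hRm (n : ℕ) : AEMeasurable (R n) P := by
    refine AEMeasurable.const_mul (AEMeasurable.add ?_ ?_) 2
    · exact ((hLm n).sub aestronglyMeasurable_const).norm.aemeasurable
    · exact ((hθm n).sub_const θ₀).norm.const_mul C
  have hRsmall {η : ℝ} (hη : 0 < η) : Tendsto (fun n ↦ P {a | η ≤ R n a}) atTop (𝓝 0) := by
    have h1 := tendsto_measure_le_norm_sampleMean_sub hX hind h.integrable_deriv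
      (show 0 < η / 4 by positivity)
    have h2 := tendstoInMeasure_iff_norm.1 hcons (η / (4 * C)) (by positivity)
    rw [h.integral_deriv] at h1
    refine tendsto_measure_zero_of_ae_imp h1 h2 (.of_forall fun n ↦ ae_of_all _ fun a ha ↦ ?_)
    simp only [Set.mem_ofPred_eq, R] at ha ⊢
    by_contra! hcon
    have := mul_lt_mul_of_pos_left hcon.2 hCpos
    have h3 : C * (η / (4 * C)) = η / 4 := by field_simp
    rw [h3] at this
    linarith [hcon.1]
  have hR : TendstoInMeasure P R atTop (fun _ ↦ 0) := by
    rw [tendstoInMeasure_iff_norm]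
    intro ε hε
    convert hRsmall hε using 5 with n a
    rw [sub_zero, Real.norm_of_nonneg (by positivity)]
  have hneg := tendstoInMeasure_smul_of_tendstoInDistribution hclt hR hRm
  refine tendstoInDistribution_of_tendstoInMeasure_sub _ Z hclt ?_
    fun n ↦ AEMeasurable.fun_const_smul ((hθm n).sub_const θ₀) _
  rw [tendstoInMeasure_iff_norm] at hneg ⊢
  intro ε hε
  have hbad := h.tendsto_measure_bad hX hind one_pos one_pos
  have hball := tendstoInMeasure_iff_norm.1 hcons r h.pos
  have hA1 := tendsto_measure_zero_of_ae_imp (A := fun n ↦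
    {a | sampleMean (φ (θhat n (sample X n a))) (sample X n a) ≠ 0 ∨ 1 ≤ R n a}) hroot
    (hRsmall one_pos) (.of_forall fun n ↦ ae_of_all _ fun a ha ↦ ha)
  have hA2 := tendsto_measure_zero_of_ae_imp (A := fun n ↦
    {a | ¬ (‖sampleMean (φ θ₀) (sample X n a)‖ < 1 ∧
      ‖sampleMean L (sample X n a) - ContinuousLinearMap.id ℝ E‖ < 1 ∧
      sampleMean m (sample X n a) < C) ∨ r ≤ ‖θhat n (sample X n a) - θ₀‖}) hbad hball
    (.of_forall fun n ↦ ae_of_all _ fun a ha ↦ ha)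
  have hA3 := tendsto_measure_zero_of_ae_imp (A := fun n ↦ {a | (_ ∨ _) ∨ (_ ∨ _)}) hA1 hA2
    (.of_forall fun n ↦ ae_of_all _ fun a ha ↦ ha)
  refine tendsto_measure_zero_of_ae_imp (hneg ε hε) hA3
    ((eventually_gt_atTop 0).mono fun n hn ↦ ?_)
  filter_upwards [ae_forall_law hX h.approx] with a ha hεa
  simp only [sub_zero, Pi.sub_apply, Pi.zero_apply] at hεa ⊢
  by_contra! hcon
  obtain ⟨hlt, ⟨hroot0, hR1⟩, ⟨-, -, hmC⟩, hr⟩ := hcon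
  set θ := θhat n (sample X n a)
  have hnpos : (0 : ℝ) < n := Nat.cast_pos.2 hn
  have hsum : (√(n : ℝ))⁻¹ • ∑ i ∈ Finset.range n, -φ θ₀ (X i a) =
      -(√(n : ℝ) • sampleMean (φ θ₀) (sample X n a)) := by
    rw [sampleMean_sample, smul_smul, Finset.sum_neg_distrib, smul_neg]
    congr 2
    rw [← div_eq_mul_inv, Real.sqrt_div_self', one_div]
  have hlin := norm_sampleMean_sub_le (x := sample X n a) (fun i ↦ ha i) hr.le (θ := θ) (θ' := θ₀)
    (by simp [dist_eq_norm]) (by simp)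
  rw [hroot0, zero_sub] at hlin
  have hhalf : ‖sampleMean L (sample X n a) - ContinuousLinearMap.id ℝ E‖ +
      ‖θ - θ₀‖ * sampleMean m (sample X n a) ≤ R n a / 2 := by
    have : ‖θ - θ₀‖ * sampleMean m (sample X n a) ≤ C * ‖θ - θ₀‖ := by
      rw [mul_comm]; gcongr
    simp only [R]
    linarith
  have hlin' := hlin.trans (mul_le_mul_of_nonneg_right hhalf (norm_nonneg _))
  -- since the relative error is at most `1/2`, the root is controlled by the sample mean at `θ₀`
  have hθle : ‖θ - θ₀‖ ≤ 2 * ‖sampleMean (φ θ₀) (sample X n a)‖ := by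
    have h1 := norm_sub_le_norm_sub_add_norm_sub
      (0 : E) (-sampleMean (φ θ₀) (sample X n a)) (θ - θ₀)
    rw [zero_sub, norm_neg, sub_neg_eq_add, zero_add] at h1
    have h2 := mul_le_mul_of_nonneg_right hR1.le (norm_nonneg (θ - θ₀))
    linarith
  have hRnn : 0 ≤ R n a := by positivity
  have hfin : ‖√(n : ℝ) • (θ - θ₀) - (√(n : ℝ))⁻¹ • ∑ i ∈ Finset.range n, -φ θ₀ (X i a)‖ ≤
      ‖R n a • (√(n : ℝ))⁻¹ • ∑ i ∈ Finset.range n, -φ θ₀ (X i a)‖ := by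
    rw [hsum, ← norm_neg, show -(√(n : ℝ) • (θ - θ₀) - -(√(n : ℝ) • sampleMean (φ θ₀)
      (sample X n a))) = √(n : ℝ) • (-sampleMean (φ θ₀) (sample X n a) - (θ - θ₀)) by
        simp only [smul_sub, smul_neg]; abel, smul_neg, norm_neg, norm_smul, norm_smul, norm_smul,
      Real.norm_of_nonneg (Real.sqrt_nonneg _), Real.norm_of_nonneg hRnn]
    calc √(n : ℝ) * ‖-sampleMean (φ θ₀) (sample X n a) - (θ - θ₀)‖
        ≤ √(n : ℝ) * (R n a / 2 * (2 * ‖sampleMean (φ θ₀) (sample X n a)‖)) := by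
          gcongr
          exact hlin'.trans (by gcongr)
      _ = _ := by ring
  linarith

end ZEstimation

/-! ### Partial derivatives and second-order expansion -/

section Calculus

variable {s : ℕ}

lemma clm_apply_eq_sum (Λ : Param s →L[ℝ] ℝ) (v : Param s) :
    Λ v = ∑ j, Λ (EuclideanSpace.single j 1) * v j := by
  conv_lhs => rw [← (EuclideanSpace.basisFun (Fin s) ℝ).sum_repr v, map_sum]
  simp [mul_comm]

lemma abs_apply_le_norm (v : Param s) (j : Fin s) : |v j| ≤ ‖v‖ := PiLp.norm_apply_le v j

lemma norm_clm_le_sum (Λ : Param s →L[ℝ] ℝ) : ‖Λ‖ ≤ ∑ j, |Λ (EuclideanSpace.single j 1)| := by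
  refine Λ.opNorm_le_bound (Finset.sum_nonneg fun _ _ ↦ abs_nonneg _) fun v ↦ ?_
  rw [clm_apply_eq_sum, Finset.sum_mul]
  refine norm_sum_le_of_le _ fun j _ ↦ ?_
  rw [norm_mul, Real.norm_eq_abs, Real.norm_eq_abs]
  gcongr
  exact abs_apply_le_norm v j

lemma norm_param_le_sum (v : Param s) : ‖v‖ ≤ ∑ k, |v k| := by
  conv_lhs => rw [← (EuclideanSpace.basisFun (Fin s) ℝ).sum_repr v]
  refine norm_sum_le_of_le _ fun k _ ↦ ?_
  simp [norm_smul]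

lemma pd_congr {ω : Set (Param s)} (hω : IsOpen ω) {F G : Param s → ℝ} (h : Set.EqOn F G ω)
    (k : Fin s) : Set.EqOn (pd k F) (pd k G) ω := by
  intro θ hθ
  rw [pd, pd, (h.eventuallyEq_of_mem (hω.mem_nhds hθ)).fderiv_eq]

lemma pd_sub_const_mul {ω : Set (Param s)} (hω : IsOpen ω) {F G : Param s → ℝ}
    (hF : DifferentiableOn ℝ F ω) (hG : DifferentiableOn ℝ G ω) (c : ℝ) (k : Fin s) :
    Set.EqOn (pd k fun t ↦ F t - c * G t) (fun t ↦ pd k F t - c * pd k G t) ω := by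
  intro θ hθ
  have hF' := (hF θ hθ).differentiableAt (hω.mem_nhds hθ)
  have hG' := (hG θ hθ).differentiableAt (hω.mem_nhds hθ)
  simp [pd, fderiv_fun_sub hF' (hG'.const_mul c), fderiv_const_mul hG']

section SubConstMul

variable {ω : Set (Param s)} {F G : Param s → ℝ}

lemma ThriceDiffOn.pd_pd_sub_const_mul (hω : IsOpen ω) (hF : ThriceDiffOn F ω)
    (hG : ThriceDiffOn G ω) (c : ℝ) (j k : Fin s) :
    Set.EqOn (pd j (pd k fun t ↦ F t - c * G t))
      (fun t ↦ pd j (pd k F) t - c * pd j (pd k G) t) ω :=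
  (pd_congr hω (MinBregman.pd_sub_const_mul hω hF.1 hG.1 c k) j).trans
    (MinBregman.pd_sub_const_mul hω (hF.2.1 k) (hG.2.1 k) c j)

lemma ThriceDiffOn.sub_const_mul (hω : IsOpen ω) (hF : ThriceDiffOn F ω)
    (hG : ThriceDiffOn G ω) (c : ℝ) : ThriceDiffOn (fun t ↦ F t - c * G t) ω := by
  refine ⟨hF.1.sub (hG.1.const_mul c), fun j ↦ ?_, fun j k ↦ ?_⟩
  · exact ((hF.2.1 j).sub ((hG.2.1 j).const_mul c)).congr
      (MinBregman.pd_sub_const_mul hω hF.1 hG.1 c j)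
  · exact ((hF.2.2 j k).sub ((hG.2.2 j k).const_mul c)).congr
      (hF.pd_pd_sub_const_mul hω hG c j k)

end SubConstMul

/-- The gradient of a function with bounded third partial derivatives is linear near `θ₀` up to an
error of second order, the linear part being given by the Hessian matrix at `θ₀`. -/
lemma norm_gradient_sub_le {ω : Set (Param s)} (hω : IsOpen ω) {H : Param s → ℝ}
    (hH : ThriceDiffOn H ω) {M : Fin s → Fin s → Fin s → ℝ}
    (hM : ∀ i j k, ∀ θ ∈ ω, |pd i (pd j (pd k H)) θ| ≤ M i j k) {θ₀ : Param s} {ρ : ℝ}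
    (hρ : Metric.closedBall θ₀ ρ ⊆ ω) {θ θ' : Param s} (hθ : θ ∈ Metric.closedBall θ₀ ρ)
    (hθ' : θ' ∈ Metric.closedBall θ₀ ρ) :
    ‖WithLp.toLp 2 (fun k ↦ pd k H θ) - WithLp.toLp 2 (fun k ↦ pd k H θ') -
      Matrix.toEuclideanCLM (𝕜 := ℝ) (Matrix.of fun k j ↦ pd j (pd k H) θ₀) (θ - θ')‖ ≤
      (∑ k, ∑ j, ∑ i, M i j k) * ρ * ‖θ - θ'‖ := by
  have hconv := convex_closedBall θ₀ ρ
  have hρ0 : 0 ≤ ρ := dist_nonneg.trans hθ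
  have hc : θ₀ ∈ Metric.closedBall θ₀ ρ := Metric.mem_closedBall_self hρ0
  have h3 (j k : Fin s) (t : Param s) (ht : t ∈ Metric.closedBall θ₀ ρ) :
      |pd j (pd k H) t - pd j (pd k H) θ₀| ≤ (∑ i, M i j k) * ρ := by
    have hb : ∀ u ∈ Metric.closedBall θ₀ ρ, ‖fderiv ℝ (pd j (pd k H)) u‖ ≤ ∑ i, M i j k :=
      fun u hu ↦ (norm_clm_le_sum _).trans (Finset.sum_le_sum fun i _ ↦ hM i j k u (hρ hu))
    have h := hconv.norm_image_sub_le_of_norm_fderiv_le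
      (fun u hu ↦ (hH.2.2 j k u (hρ hu)).differentiableAt (hω.mem_nhds (hρ hu))) hb hc ht
    refine h.trans (mul_le_mul_of_nonneg_left ?_ ((norm_nonneg _).trans (hb _ hc)))
    simpa [dist_eq_norm] using ht
  have h2 (k : Fin s) : |pd k H θ - pd k H θ' - fderiv ℝ (pd k H) θ₀ (θ - θ')| ≤
      (∑ j, ∑ i, M i j k) * ρ * ‖θ - θ'‖ := by
    refine hconv.norm_image_sub_le_of_norm_fderiv_le'
      (fun u hu ↦ (hH.2.1 k u (hρ hu)).differentiableAt (hω.mem_nhds (hρ hu))) (fun u hu ↦ ?_)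
      hθ' hθ
    rw [Finset.sum_mul]
    exact (norm_clm_le_sum _).trans (Finset.sum_le_sum fun j _ ↦ h3 j k u hu)
  refine (norm_param_le_sum _).trans ?_
  rw [Finset.sum_mul, Finset.sum_mul]
  refine Finset.sum_le_sum fun k _ ↦ ?_
  have h4 : Matrix.toEuclideanCLM (𝕜 := ℝ) (Matrix.of fun k j ↦ pd j (pd k H) θ₀) (θ - θ') k =
      fderiv ℝ (pd k H) θ₀ (θ - θ') := by
    rw [clm_apply_eq_sum, Matrix.ofLp_toEuclideanCLM]
    rfl
  have h5 := h2 k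
  rwa [← h4] at h5

end Calculus

/-! ### Matrices with random entries -/

section RandomMatrix

variable {s : ℕ} {𝒳 : Type*} [MeasurableSpace 𝒳] {ν : Measure 𝒳}

lemma toEuclideanCLM_eq_sum (A : Matrix (Fin s) (Fin s) ℝ) :
    Matrix.toEuclideanCLM (𝕜 := ℝ) A =
      ∑ k, ∑ j, A k j • Matrix.toEuclideanCLM (𝕜 := ℝ) (Matrix.single k j (1 : ℝ)) := by
  conv_lhs => rw [Matrix.matrix_eq_sum_single A]
  simp only [map_sum, ← map_smul, Matrix.smul_single, smul_eq_mul, mul_one]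

lemma integrable_sum_smul {F : Type*} [NormedAddCommGroup F] [NormedSpace ℝ F]
    {A : 𝒳 → Matrix (Fin s) (Fin s) ℝ} (hA : ∀ k j, Integrable (fun x ↦ A x k j) ν)
    (c : Fin s → Fin s → F) : Integrable (fun x ↦ ∑ k, ∑ j, A x k j • c k j) ν :=
  integrable_finsetSum _ fun k _ ↦ integrable_finsetSum _ fun j _ ↦ (hA k j).smul_const _

lemma integral_sum_smul {F : Type*} [NormedAddCommGroup F] [NormedSpace ℝ F] [CompleteSpace F]
    {A : 𝒳 → Matrix (Fin s) (Fin s) ℝ} (hA : ∀ k j, Integrable (fun x ↦ A x k j) ν)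
    (c : Fin s → Fin s → F) :
    ∫ x, (∑ k, ∑ j, A x k j • c k j) ∂ν = ∑ k, ∑ j, (∫ x, A x k j ∂ν) • c k j := by
  rw [integral_finsetSum _ fun k _ ↦ integrable_finsetSum _ fun j _ ↦ (hA k j).smul_const _]
  refine Finset.sum_congr rfl fun k _ ↦ ?_
  rw [integral_finsetSum _ fun j _ ↦ (hA k j).smul_const _]
  simp [integral_smul_const]

lemma integrable_toEuclideanCLM {A : 𝒳 → Matrix (Fin s) (Fin s) ℝ}
    (hA : ∀ k j, Integrable (fun x ↦ A x k j) ν) :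
    Integrable (fun x ↦ Matrix.toEuclideanCLM (𝕜 := ℝ) (A x)) ν :=
  (integrable_sum_smul hA _).congr (ae_of_all _ fun x ↦ (toEuclideanCLM_eq_sum (A x)).symm)

lemma integral_toEuclideanCLM {A : 𝒳 → Matrix (Fin s) (Fin s) ℝ}
    (hA : ∀ k j, Integrable (fun x ↦ A x k j) ν) :
    ∫ x, Matrix.toEuclideanCLM (𝕜 := ℝ) (A x) ∂ν =
      Matrix.toEuclideanCLM (𝕜 := ℝ) (Matrix.of fun k j ↦ ∫ x, A x k j ∂ν) := by
  rw [toEuclideanCLM_eq_sum (Matrix.of _), integral_congr_ae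
    (ae_of_all _ fun x ↦ toEuclideanCLM_eq_sum (A x)), integral_sum_smul hA]
  rfl

lemma inner_toEuclideanCLM_of_isHermitian {A : Matrix (Fin s) (Fin s) ℝ} (hA : A.IsHermitian)
    (t u : Param s) :
    inner ℝ t (Matrix.toEuclideanCLM (𝕜 := ℝ) A u) =
      inner ℝ (Matrix.toEuclideanCLM (𝕜 := ℝ) A t) u := by
  conv_rhs => rw [← hA.eq, ← Matrix.star_eq_conjTranspose, map_star,
    ContinuousLinearMap.star_eq_adjoint, ContinuousLinearMap.adjoint_inner_left]

/-- The covariance matrix of a linear image of a square integrable random vector. -/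
lemma integral_inner_sq_eq [IsProbabilityMeasure ν] {w : 𝒳 → Param s} (hw : MemLp w 2 ν)
    {A : Matrix (Fin s) (Fin s) ℝ} (hA : A.IsHermitian) {C : Matrix (Fin s) (Fin s) ℝ}
    {ξ : Param s} (hξ : ∀ k, ∫ x, w x k ∂ν = ξ k)
    (hC : ∀ k l, C k l = (∫ x, w x k * w x l ∂ν) - ξ k * ξ l) (t : Param s) :
    ∫ x, inner ℝ t (Matrix.toEuclideanCLM (𝕜 := ℝ) A (w x - ξ)) ^ 2 ∂ν =
      t.ofLp ⬝ᵥ (A * C * A).mulVec t.ofLp := by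
  have hwk (k : Fin s) : MemLp (fun x ↦ w x k) 2 ν := hw.eval_piLp k
  have hwi (k : Fin s) : Integrable (fun x ↦ w x k) ν := (hwk k).integrable (by norm_num)
  have hwkl (k l : Fin s) : Integrable (fun x ↦ w x k * w x l) ν :=
    MemLp.integrable_mul (hwk k) (hwk l)
  have hint (k l : Fin s) : Integrable (fun x ↦ (w x k - ξ k) * (w x l - ξ l)) ν :=
    MemLp.integrable_mul ((hwk k).sub (memLp_const _)) ((hwk l).sub (memLp_const _))
  have hprod (k l : Fin s) : ∫ x, (w x k - ξ k) * (w x l - ξ l) ∂ν = C k l := by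
    have h (x : 𝒳) : (w x k - ξ k) * (w x l - ξ l) =
        w x k * w x l - w x k * ξ l - ξ k * w x l + ξ k * ξ l := by ring
    have i1 : Integrable (fun x ↦ w x k * w x l - w x k * ξ l) ν :=
      (hwkl k l).sub ((hwi k).mul_const _)
    have i2 : Integrable (fun x ↦ w x k * w x l - w x k * ξ l - ξ k * w x l) ν :=
      i1.sub ((hwi l).const_mul _)
    simp_rw [h]
    rw [integral_add i2 (integrable_const _), integral_sub i1 ((hwi l).const_mul _),
      integral_sub (hwkl k l) ((hwi k).mul_const _), integral_mul_const, integral_const_mul,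
      hξ, hξ, hC]
    simp
  set u := Matrix.toEuclideanCLM (𝕜 := ℝ) A t with hu
  have hexp (x : 𝒳) : inner ℝ t (Matrix.toEuclideanCLM (𝕜 := ℝ) A (w x - ξ)) ^ 2 =
      ∑ k, ∑ l, u k * u l * ((w x k - ξ k) * (w x l - ξ l)) := by
    rw [inner_toEuclideanCLM_of_isHermitian hA, ← hu, PiLp.inner_apply, sq, Finset.sum_mul_sum]
    refine Finset.sum_congr rfl fun k _ ↦ Finset.sum_congr rfl fun l _ ↦ ?_
    simp
    ring
  simp_rw [hexp]
  rw [integral_finsetSum _ fun k _ ↦ integrable_finsetSum _ fun l _ ↦ (hint k l).const_mul _]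
  simp_rw [integral_finsetSum _ fun l _ ↦ (hint _ l).const_mul _, integral_const_mul, hprod]
  rw [← Matrix.inner_toEuclideanCLM, map_mul, map_mul, mul_apply_eq_comp,
    mul_apply_eq_comp, inner_toEuclideanCLM_of_isHermitian hA, ← hu,
    Matrix.inner_toEuclideanCLM]
  simp only [dotProduct, Matrix.mulVec, Finset.mul_sum]
  exact Finset.sum_congr rfl fun k _ ↦ Finset.sum_congr rfl fun l _ ↦ by ring

end RandomMatrix

/-! ### The gradient of the empirical Bregman divergence -/

section Bregman

/-- The weighted score is the gradient of `B'(f_θ(x))` wherever the density is positive. -/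
lemma pd_deriv_comp {s : ℕ} {𝒳 : Type*} {B : ℝ → ℝ} {f : Param s → 𝒳 → ℝ}
    (hB : IsBregmanGenerator B) {x : 𝒳} {θ : Param s}
    (hd : DifferentiableAt ℝ (fun t ↦ f t x) θ) (hpos : 0 < f θ x) (k : Fin s) :
    pd k (fun t ↦ deriv B (f t x)) θ = wscore B f θ x k := by
  have hB' : DifferentiableAt ℝ (deriv B) (f θ x) :=
    (hB.diff_deriv _ hpos).differentiableAt (Ioi_mem_nhds hpos)
  have h1 : fderiv ℝ (fun t ↦ deriv B (f t x)) θ =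
      deriv (deriv B) (f θ x) • fderiv ℝ (fun t ↦ f t x) θ :=
    (HasDerivAt.comp_hasFDerivAt (h₂ := deriv B) (f := fun t ↦ f t x) θ hB'.hasDerivAt
      hd.hasFDerivAt).fderiv
  have h2 : score f θ x k = (f θ x)⁻¹ * fderiv ℝ (fun t ↦ f t x) θ (EuclideanSpace.single k 1) := by
    have h3 : score f θ x k = inner ℝ (score f θ x) (EuclideanSpace.single k (1 : ℝ)) := by
      simp [EuclideanSpace.inner_single_right]
    rw [h3, score, gradient, InnerProductSpace.toDual_symm_apply, fderiv.log hd hpos.ne']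
    simp
  rw [pd, h1, wscore, PiLp.smul_apply, h2, smul_eq_mul]
  simp only [smul_apply, smul_eq_mul]
  field_simp

lemma pd_penalty {s : ℕ} {𝒳 : Type*} {B : ℝ → ℝ} {f : Param s → 𝒳 → ℝ}
    (hB : IsBregmanGenerator B) {x : 𝒳} {θ : Param s}
    (hd : DifferentiableAt ℝ (fun t ↦ f t x) θ) (hpos : 0 < f θ x) (k : Fin s) :
    pd k (fun t ↦ penalty B f t x) θ = f θ x * wscore B f θ x k := by
  have hB1 : DifferentiableAt ℝ B (f θ x) :=
    (hB.diff _ hpos).differentiableAt (Ioi_mem_nhds hpos)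
  have hB' : DifferentiableAt ℝ (deriv B) (f θ x) :=
    (hB.diff_deriv _ hpos).differentiableAt (Ioi_mem_nhds hpos)
  have h1 := hB1.hasDerivAt.comp_hasFDerivAt θ hd.hasFDerivAt
  have h2 := hB'.hasDerivAt.comp_hasFDerivAt θ hd.hasFDerivAt
  have h3 := (hd.hasFDerivAt.mul h2).sub h1
  rw [← pd_deriv_comp hB hd hpos, pd, pd, show (fun t ↦ deriv B (f t x)) =
    deriv B ∘ fun t ↦ f t x from rfl, h2.fderiv, show (fun t ↦ penalty B f t x) =
    (fun t ↦ f t x) * (deriv B ∘ fun t ↦ f t x) - B ∘ fun t ↦ f t x from rfl, h3.fderiv]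
  simp

variable {s : ℕ} {𝒳 : Type*} [MeasurableSpace 𝒳] {μ : Measure 𝒳} {B : ℝ → ℝ}
  {f : Param s → 𝒳 → ℝ} {g : 𝒳 → ℝ} {Ω ω : Set (Param s)} {θg : Param s} {χ : Set 𝒳}

/-- The drift `∫ u_θ B''(f_θ) f_θ² dμ` of the estimating equation. -/
noncomputable def drift (μ : Measure 𝒳) (B : ℝ → ℝ) (f : Param s → 𝒳 → ℝ) (θ : Param s) :
    Param s :=
  ∫ y, f θ y • wscore B f θ y ∂μ

lemma isProbabilityMeasure_distr (hg : IsDensity μ g) : IsProbabilityMeasure (distr μ g) :=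
  ⟨by rw [distr, withDensity_apply _ MeasurableSet.univ, Measure.restrict_univ,
    hg.lintegral_eq_one]⟩

lemma ae_distr_iff (hg : IsDensity μ g) {p : 𝒳 → Prop} :
    (∀ᵐ x ∂(distr μ g), p x) ↔ ∀ᵐ x ∂μ, 0 < g x → p x := by
  rw [distr, ae_withDensity_iff hg.measurable.ennreal_ofReal]
  simp

lemma integrable_distr_iff (hg : IsDensity μ g) {F : Type*} [NormedAddCommGroup F]
    [NormedSpace ℝ F] {h : 𝒳 → F} :
    Integrable h (distr μ g) ↔ Integrable (fun x ↦ g x • h x) μ := by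
  rw [distr, integrable_withDensity_iff_integrable_smul' hg.measurable.ennreal_ofReal
    (ae_of_all _ fun _ ↦ ENNReal.ofReal_lt_top)]
  simp_rw [ENNReal.toReal_ofReal (hg.nonneg _)]

lemma integral_distr (hg : IsDensity μ g) {F : Type*} [NormedAddCommGroup F]
    [NormedSpace ℝ F] (h : 𝒳 → F) : ∫ x, h x ∂(distr μ g) = ∫ x, g x • h x ∂μ := by
  rw [distr, integral_withDensity_eq_integral_toReal_smul hg.measurable.ennreal_ofReal
    (ae_of_all _ fun _ ↦ ENNReal.ofReal_lt_top)]
  simp_rw [ENNReal.toReal_ofReal (hg.nonneg _)]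

/-- Almost everywhere on the common support the densities are positive and differentiable in the
parameter. -/
lemma ae_pos_and_differentiableAt (hA1 : CondA1 μ f g Ω χ) (hA2 : CondA2 μ f Ω χ ω θg) :
    ∀ᵐ x ∂μ, x ∈ χ → ∀ θ ∈ ω, 0 < f θ x ∧ DifferentiableAt ℝ (fun t ↦ f t x) θ := by
  filter_upwards [hA2.2.2.2] with x hx hxχ θ hθ
  refine ⟨?_, ((hx hxχ).differentiableOn (by norm_num) θ hθ).differentiableAt
    (hA2.1.mem_nhds hθ)⟩
  have : x ∈ {x | 0 < f θ x} := (hA1.1 θ (hA2.2.1 hθ)).symm ▸ hxχ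
  exact this

lemma ae_pd_penalty (hB : IsBregmanGenerator B) (hf : ∀ θ ∈ Ω, IsDensity μ (f θ))
    (hA1 : CondA1 μ f g Ω χ) (hA2 : CondA2 μ f Ω χ ω θg) :
    ∀ᵐ x ∂μ, ∀ θ ∈ ω, ∀ k,
      pd k (fun t ↦ penalty B f t x) θ = (f θ x • wscore B f θ x) k := by
  filter_upwards [ae_pos_and_differentiableAt hA1 hA2] with x hx θ hθ k
  by_cases hxχ : x ∈ χ
  · obtain ⟨hpos, hd⟩ := hx hxχ θ hθ
    exact pd_penalty hB hd hpos k
  · -- outside the common support all the densities vanish, and the integrand is constant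
    have h0 : ∀ t ∈ ω, f t x = 0 := fun t ht ↦ by
      have hx' : x ∉ {x | 0 < f t x} := by rwa [hA1.1 t (hA2.2.1 ht)]
      exact le_antisymm (not_lt.1 hx') ((hf t (hA2.2.1 ht)).nonneg x)
    have hconst : Set.EqOn (fun t ↦ penalty B f t x) (fun _ ↦ -B 0) ω := fun t ht ↦ by
      simp [penalty, h0 t ht]
    rw [pd_congr hA2.1 hconst k hθ, h0 θ hθ]
    simp [pd]

lemma integrable_smul_wscore (hB : IsBregmanGenerator B) (hf : ∀ θ ∈ Ω, IsDensity μ (f θ))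
    (hA1 : CondA1 μ f g Ω χ) (hA2 : CondA2 μ f Ω χ ω θg) (hA3 : CondA3 μ B f g ω)
    {θ : Param s} (hθ : θ ∈ ω) (k : Fin s) :
    Integrable (fun y ↦ (f θ y • wscore B f θ y) k) μ := by
  refine (hA3.1.first θ hθ k).1.congr ?_
  filter_upwards [ae_pd_penalty hB hf hA1 hA2] with x hx using hx θ hθ k

/-- The drift is the gradient of `∫ [f_θ B'(f_θ) - B(f_θ)] dμ`. -/
lemma drift_apply (hB : IsBregmanGenerator B) (hf : ∀ θ ∈ Ω, IsDensity μ (f θ))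
    (hA1 : CondA1 μ f g Ω χ) (hA2 : CondA2 μ f Ω χ ω θg) (hA3 : CondA3 μ B f g ω)
    {θ : Param s} (hθ : θ ∈ ω) (k : Fin s) :
    drift μ B f θ k = pd k (fun t ↦ ∫ x, penalty B f t x ∂μ) θ := by
  rw [drift, eval_integral_piLp fun i ↦ integrable_smul_wscore hB hf hA1 hA2 hA3 hθ i,
    (hA3.1.first θ hθ k).2]
  refine integral_congr_ae ?_
  filter_upwards [ae_pd_penalty hB hf hA1 hA2] with x hx using (hx θ hθ k).symm

lemma V_eq {x : 𝒳} (hx : g x ≠ 0) :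
    (fun t ↦ V μ B f t x) =
      fun t ↦ (∫ y, penalty B f t y ∂μ) - (g x)⁻¹ * (deriv B (f t x) * g x) := by
  funext t
  rw [V]
  field_simp

lemma ae_distr_of_ae {p : 𝒳 → Prop} (h : ∀ᵐ x ∂μ, p x) : ∀ᵐ x ∂(distr μ g), p x :=
  (withDensity_absolutelyContinuous μ _).ae_le h

lemma ae_distr_pos (hg : IsDensity μ g) : ∀ᵐ x ∂(distr μ g), 0 < g x :=
  (ae_distr_iff hg).2 (ae_of_all _ fun _ h ↦ h)

lemma ae_thriceDiffOn_V (hg : IsDensity μ g) (hA2 : CondA2 μ f Ω χ ω θg)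
    (hA3 : CondA3 μ B f g ω) :
    ∀ᵐ x ∂(distr μ g), ThriceDiffOn (fun t ↦ V μ B f t x) ω := by
  filter_upwards [ae_distr_pos hg, ae_distr_of_ae hA3.2.pointwise] with x hgx hx
  rw [V_eq hgx.ne']
  exact hA3.1.integral.sub_const_mul hA2.1 hx _

/-- The gradient of `V_θ(x)` is the summand of the estimating equation. -/
lemma ae_pd_V (hB : IsBregmanGenerator B) (hf : ∀ θ ∈ Ω, IsDensity μ (f θ))
    (hA1 : CondA1 μ f g Ω χ) (hA2 : CondA2 μ f Ω χ ω θg) (hA3 : CondA3 μ B f g ω) :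
    ∀ᵐ x ∂(distr μ g), ∀ θ ∈ ω, ∀ k,
      pd k (fun t ↦ V μ B f t x) θ = (drift μ B f θ - wscore B f θ x) k := by
  have hχ : ∀ᵐ x ∂(distr μ g), x ∈ χ := mem_ae_iff.2 hA1.2.2
  filter_upwards [hχ, ae_distr_of_ae (ae_pos_and_differentiableAt hA1 hA2)] with x hxχ hx θ hθ k
  obtain ⟨hpos, hd⟩ := hx hxχ θ hθ
  have hB' : DifferentiableAt ℝ (fun t ↦ deriv B (f t x)) θ :=
    DifferentiableAt.comp (g := deriv B) θ
      ((hB.diff_deriv _ hpos).differentiableAt (Ioi_mem_nhds hpos)) hd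
  have ha := (hA3.1.integral.1 θ hθ).differentiableAt (hA2.1.mem_nhds hθ)
  rw [PiLp.sub_apply, drift_apply hB hf hA1 hA2 hA3 hθ, ← pd_deriv_comp hB hd hpos, pd, pd, pd]
  unfold V
  rw [fderiv_fun_sub ha hB', sub_apply]

lemma integrable_inv_mul (hg : IsDensity μ g) {h : 𝒳 → ℝ} (hh : Integrable h μ) :
    Integrable (fun x ↦ (g x)⁻¹ * h x) (distr μ g) := by
  rw [integrable_distr_iff hg]
  refine (hh.indicator (hg.measurable (measurableSet_singleton 0).compl)).congr
    (ae_of_all _ fun x ↦ ?_)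
  by_cases hx : g x = 0
  · simp [hx]
  · simp [hx]

lemma integrable_wscore (hB : IsBregmanGenerator B) (hf : ∀ θ ∈ Ω, IsDensity μ (f θ))
    (hg : IsDensity μ g) (hA1 : CondA1 μ f g Ω χ) (hA2 : CondA2 μ f Ω χ ω θg)
    (hA3 : CondA3 μ B f g ω) {θ : Param s} (hθ : θ ∈ ω) :
    Integrable (wscore B f θ) (distr μ g) := by
  refine integrable_piLp_iff.2 fun k ↦ ?_
  refine (integrable_inv_mul hg (hA3.2.first θ hθ k).1).congr ?_
  filter_upwards [ae_distr_pos hg, ae_pd_V hB hf hA1 hA2 hA3, ae_distr_of_ae hA3.2.pointwise]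
    with x hgx hV hx
  have h1 := hV θ hθ k
  rw [V_eq hgx.ne', pd_sub_const_mul hA2.1 hA3.1.integral.1 hx.1 _ k hθ, PiLp.sub_apply,
    drift_apply hB hf hA1 hA2 hA3 hθ] at h1
  exact sub_right_injective h1

lemma integrable_pd_pd_V (hg : IsDensity μ g) (hA2 : CondA2 μ f Ω χ ω θg)
    (hA3 : CondA3 μ B f g ω) {θ : Param s} (hθ : θ ∈ ω) (j k : Fin s) :
    Integrable (fun x ↦ pd j (pd k (fun t ↦ V μ B f t x)) θ) (distr μ g) := by
  have := isProbabilityMeasure_distr hg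
  refine ((integrable_const (pd j (pd k fun t ↦ ∫ y, penalty B f t y ∂μ) θ)).sub
    (integrable_inv_mul hg (hA3.2.second θ hθ j k).1)).congr ?_
  filter_upwards [ae_distr_pos hg, ae_distr_of_ae hA3.2.pointwise] with x hgx hx
  rw [V_eq hgx.ne', hA3.1.integral.pd_pd_sub_const_mul hA2.1 hx _ j k hθ]
  rfl

lemma integral_wscore_eq_drift (hf : ∀ θ ∈ Ω, IsDensity μ (f θ))
    (hθg : IsBestFitting μ B f g Ω θg) :
    ∫ x, wscore B f θg x ∂(distr μ g) = drift μ B f θg := by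
  rw [hθg.2, integral_distr (hf θg hθg.1), drift]

/-- The estimating function `J⁻¹ ∇V_θ(x)`, normalized by the expected Hessian `J` at `θ_g`. -/
noncomputable def normalizedScore (μ : Measure 𝒳) (B : ℝ → ℝ) (f : Param s → 𝒳 → ℝ) (g : 𝒳 → ℝ)
    (θg : Param s) (θ : Param s) (x : 𝒳) : Param s :=
  Matrix.toEuclideanCLM (𝕜 := ℝ) (J μ B f g θg)⁻¹ (drift μ B f θ - wscore B f θ x)

/-- For a nonempty sample the estimating equation says that the mean of the normalized estimating
functions vanishes. -/
lemma sampleMean_normalizedScore_eq_zero_iff (hJ : (J μ B f g θg).PosDef) {n : ℕ} (hn : n ≠ 0)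
    (x : Fin n → 𝒳) (θ : Param s) :
    sampleMean (normalizedScore μ B f g θg θ) x = 0 ↔ EstimatingEq μ B f x θ := by
  have hn' : (n : ℝ) ≠ 0 := Nat.cast_ne_zero.2 hn
  have h1 : sampleMean (normalizedScore μ B f g θg θ) x =
      Matrix.toEuclideanCLM (𝕜 := ℝ) (J μ B f g θg)⁻¹
        (drift μ B f θ - (n : ℝ)⁻¹ • ∑ i, wscore B f θ (x i)) := by
    simp only [sampleMean, normalizedScore]
    rw [← map_sum, ← map_smul, Finset.sum_sub_distrib, smul_sub, Finset.sum_const,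
      Finset.card_univ, Fintype.card_fin, ← Nat.cast_smul_eq_nsmul ℝ, inv_smul_smul₀ hn']
  have hinj : ∀ v, Matrix.toEuclideanCLM (𝕜 := ℝ) (J μ B f g θg)⁻¹ v = 0 → v = 0 := by
    intro v hv
    have h2 : Matrix.toEuclideanCLM (𝕜 := ℝ) (J μ B f g θg * (J μ B f g θg)⁻¹) v = 0 := by
      rw [map_mul, mul_apply_eq_comp, hv, map_zero]
    rw [Matrix.mul_nonsing_inv _ ((Matrix.isUnit_iff_isUnit_det _).1 hJ.isUnit), map_one] at h2
    exact h2
  rw [h1, EstimatingEq]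
  constructor
  · intro h
    exact (sub_eq_zero.1 (hinj _ h)).symm
  · intro h
    rw [h, drift, sub_self, map_zero]

/-- The regularity conditions make the normalized estimating function locally linear. -/
lemma exists_isLocallyLinear (hB : IsBregmanGenerator B) (hf : ∀ θ ∈ Ω, IsDensity μ (f θ))
    (hg : IsDensity μ g) (hθg : IsBestFitting μ B f g Ω θg) (hA1 : CondA1 μ f g Ω χ)
    (hA2 : CondA2 μ f Ω χ ω θg) (hA3 : CondA3 μ B f g ω) (hA4 : CondA4 μ B f g θg)
    (hA5 : CondA5 μ B f g ω) :
    ∃ r L m, Metric.closedBall θg r ⊆ ω ∧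
      IsLocallyLinear (distr μ g) (normalizedScore μ B f g θg) θg r L m := by
  have := isProbabilityMeasure_distr hg
  obtain ⟨r, hr, hrω⟩ := Metric.nhds_basis_closedBall.mem_iff.1 (hA2.1.mem_nhds hA2.2.2.1)
  obtain ⟨M, hM⟩ := hA5
  have hw {θ : Param s} (hθ : θ ∈ ω) := integrable_wscore hB hf hg hA1 hA2 hA3 hθ
  set Q := Matrix.toEuclideanCLM (𝕜 := ℝ) (J μ B f g θg)⁻¹ with hQ
  let H (x : 𝒳) : Matrix (Fin s) (Fin s) ℝ :=
    Matrix.of fun k j ↦ pd j (pd k (fun t ↦ V μ B f t x)) θg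
  have hHi (k j : Fin s) : Integrable (fun x ↦ H x k j) (distr μ g) :=
    integrable_pd_pd_V hg hA2 hA3 hA2.2.2.1 j k
  have hHJ (k j : Fin s) : ∫ x, H x k j ∂(distr μ g) = J μ B f g θg k j :=
    -- the Hessian enters transposed, which is harmless because `J` is symmetric
    hA4.isHermitian.apply k j
  have hLi (k j : Fin s) : Integrable (fun x ↦ ((J μ B f g θg)⁻¹ * H x) k j) (distr μ g) := by
    simp_rw [Matrix.mul_apply]
    exact integrable_finsetSum _ fun l _ ↦ (hHi l j).const_mul _
  have hLJ (k j : Fin s) : ∫ x, ((J μ B f g θg)⁻¹ * H x) k j ∂(distr μ g) =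
      (1 : Matrix (Fin s) (Fin s) ℝ) k j := by
    rw [← Matrix.nonsing_inv_mul _ ((Matrix.isUnit_iff_isUnit_det _).1 hA4.isUnit)]
    simp_rw [Matrix.mul_apply]
    rw [integral_finsetSum _ fun l _ ↦ (hHi l j).const_mul _]
    simp_rw [integral_const_mul, hHJ]
  refine ⟨r, fun x ↦ Matrix.toEuclideanCLM (𝕜 := ℝ) ((J μ B f g θg)⁻¹ * H x),
    fun x ↦ ‖Q‖ * |∑ k, ∑ j, ∑ i, M i j k x|, hrω, ?_⟩
  refine ⟨hr, fun θ hθ ↦ ?_, ?_, ?_, ?_, ?_, fun x ↦ by positivity, ?_, ?_⟩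
  · exact Q.continuous.comp_aestronglyMeasurable
      (aestronglyMeasurable_const.sub (hw (hrω hθ)).aestronglyMeasurable)
  · exact Q.integrable_comp ((integrable_const _).sub (hw hA2.2.2.1))
  · have hi : Integrable (fun x ↦ drift μ B f θg - wscore B f θg x) (distr μ g) :=
      (integrable_const _).sub (hw hA2.2.2.1)
    refine (Q.integral_comp_comm hi).trans ?_
    rw [integral_sub (integrable_const _) (hw hA2.2.2.1), integral_wscore_eq_drift hf hθg]
    simp
  · exact integrable_toEuclideanCLM hLi
  · rw [integral_toEuclideanCLM hLi]
    simp_rw [hLJ]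
    exact map_one _
  · refine Integrable.const_mul (Integrable.abs ?_) _
    exact integrable_finsetSum _ fun k _ ↦ integrable_finsetSum _ fun j _ ↦
      integrable_finsetSum _ fun i _ ↦ (hM i j k).1
  · have hM' : ∀ᵐ x ∂(distr μ g), ∀ i j k, ∀ θ ∈ ω,
        |pd i (pd j (pd k (fun t ↦ V μ B f t x))) θ| ≤ M i j k x :=
      ae_all_iff.2 fun i ↦ ae_all_iff.2 fun j ↦ ae_all_iff.2 fun k ↦ (hM i j k).2
    filter_upwards [hM', ae_thriceDiffOn_V hg hA2 hA3, ae_pd_V hB hf hA1 hA2 hA3]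
      with x hMx hV hpd ρ hρ θ hθ θ' hθ'
    have hsub : Metric.closedBall θg ρ ⊆ ω := (Metric.closedBall_subset_closedBall hρ).trans hrω
    have hgrad {t : Param s} (ht : t ∈ ω) : drift μ B f t - wscore B f t x =
        WithLp.toLp 2 fun k ↦ pd k (fun t ↦ V μ B f t x) t := by
      ext k
      exact (hpd t ht k).symm
    have key := norm_gradient_sub_le hA2.1 hV hMx hsub hθ hθ'
    rw [← hgrad (hsub hθ), ← hgrad (hsub hθ')] at key
    rw [normalizedScore, normalizedScore, map_mul, mul_apply_eq_comp, ← map_sub, ← map_sub]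
    refine (Q.le_opNorm _).trans ?_
    rw [mul_assoc, mul_assoc]
    refine mul_le_mul_of_nonneg_left (key.trans ?_) (norm_nonneg _)
    rw [← mul_assoc]
    have hρ0 : 0 ≤ ρ := dist_nonneg.trans hθ
    gcongr
    exact le_abs_self _

end Bregman

/-! ### The asymptotic covariance -/

section Covariance

variable {s : ℕ} {𝒳 : Type*} [MeasurableSpace 𝒳] {μ : Measure 𝒳} {B : ℝ → ℝ}
  {f : Param s → 𝒳 → ℝ} {g : 𝒳 → ℝ} {Ω : Set (Param s)} {θg : Param s}

lemma neg_normalizedScore (x : 𝒳) : -normalizedScore μ B f g θg θg x =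
    Matrix.toEuclideanCLM (𝕜 := ℝ) (J μ B f g θg)⁻¹ (wscore B f θg x - drift μ B f θg) := by
  rw [normalizedScore, ← map_neg, neg_sub]

lemma memLp_neg_normalizedScore (hg : IsDensity μ g) (hK : MemLp (wscore B f θg) 2 (distr μ g)) :
    MemLp (fun x ↦ -normalizedScore μ B f g θg θg x) 2 (distr μ g) := by
  have := isProbabilityMeasure_distr hg
  simp_rw [neg_normalizedScore]
  exact ContinuousLinearMap.comp_memLp' _ (hK.sub (memLp_const _))

/-- The normalized estimating function at `θ_g` has covariance matrix `J⁻¹ K J⁻¹`. -/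
lemma integral_inner_normalizedScore_sq (hf : ∀ θ ∈ Ω, IsDensity μ (f θ)) (hg : IsDensity μ g)
    (hθg : IsBestFitting μ B f g Ω θg) (hA4 : CondA4 μ B f g θg)
    (hK : MemLp (wscore B f θg) 2 (distr μ g)) (t : Param s) :
    ∫ x, inner ℝ t (-normalizedScore μ B f g θg θg x) ^ 2 ∂(distr μ g) =
      t.ofLp ⬝ᵥ ((J μ B f g θg)⁻¹ * K μ B f g θg * (J μ B f g θg)⁻¹).mulVec t.ofLp := by
  have := isProbabilityMeasure_distr hg
  have hdrift := integral_wscore_eq_drift hf hθg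
  simp_rw [neg_normalizedScore]
  refine integral_inner_sq_eq hK hA4.isHermitian.inv (fun k ↦ ?_) (fun k l ↦ ?_) t
  · rw [← hdrift, eval_integral_piLp fun i ↦ (hK.integrable (by norm_num)).eval_piLp i]
  · rw [K, Matrix.of_apply, xi, hdrift]

lemma posSemidef_sandwich (hf : ∀ θ ∈ Ω, IsDensity μ (f θ)) (hg : IsDensity μ g)
    (hθg : IsBestFitting μ B f g Ω θg) (hA4 : CondA4 μ B f g θg)
    (hK : MemLp (wscore B f θg) 2 (distr μ g)) :
    ((J μ B f g θg)⁻¹ * K μ B f g θg * (J μ B f g θg)⁻¹).PosSemidef := by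
  refine .of_dotProduct_mulVec_nonneg ?_ fun t ↦ ?_
  · have hJ := hA4.isHermitian.inv
    have hKs : (K μ B f g θg).IsHermitian := by
      ext k l
      simp [K, mul_comm]
    rw [Matrix.IsHermitian, Matrix.conjTranspose_mul, Matrix.conjTranspose_mul, hJ.eq, hKs.eq,
      Matrix.mul_assoc]
  · rw [star_trivial]
    have h := integral_inner_normalizedScore_sq hf hg hθg hA4 hK (WithLp.toLp 2 t)
    rw [← h]
    exact integral_nonneg fun _ ↦ sq_nonneg _

end Covariance

end MinBregman

theorem theorem1 {s : ℕ} {𝒳 : Type*} [MeasurableSpace 𝒳]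
    (μ : Measure 𝒳) [SigmaFinite μ]
    (B : ℝ → ℝ) (hB : IsBregmanGenerator B)
    (Ω : Set (Param s)) (f : Param s → 𝒳 → ℝ) (hf : ∀ θ ∈ Ω, IsDensity μ (f θ))
    (g : 𝒳 → ℝ) (hg : IsDensity μ g)
    (θg : Param s) (hθg : IsBestFitting μ B f g Ω θg)
    (χ : Set 𝒳) (ω : Set (Param s))
    (hA1 : CondA1 μ f g Ω χ)
    (hA2 : CondA2 μ f Ω χ ω θg)
    (hA3 : CondA3 μ B f g ω)
    (hA4 : CondA4 μ B f g θg)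
    (hA5 : CondA5 μ B f g ω)
    {Ω' : Type*} [MeasurableSpace Ω'] (P : Measure Ω') [IsProbabilityMeasure P]
    (X : ℕ → Ω' → 𝒳) (hlaw : ∀ i, HasLaw (X i) (distr μ g) P) (hindep : iIndepFun X P) :
    (∃ θhat : ∀ n : ℕ, (Fin n → 𝒳) → Param s,
      IsConsistentRootSeq P X μ B f Ω θg θhat) ∧
    (MemLp (wscore B f θg) 2 (distr μ g) →
      ∀ θhat : ∀ n : ℕ, (Fin n → 𝒳) → Param s,
        IsConsistentRootSeq P X μ B f Ω θg θhat →
        TendstoInDistribution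
          (fun (n : ℕ) (a : Ω') ↦ √(n : ℝ) • (θhat n (sample X n a) - θg)) atTop
          (id : Param s → Param s) (fun _ ↦ P)
          (multivariateGaussian (0 : Param s)
            ((J μ B f g θg)⁻¹ * K μ B f g θg * (J μ B f g θg)⁻¹))) := by
  have hroot (n : ℕ) (hn : n ≠ 0) (x : Fin n → 𝒳) (θ : Param s) :=
    sampleMean_normalizedScore_eq_zero_iff (μ := μ) (B := B) (f := f) hA4 hn x θ
  obtain ⟨r, L, m, hrω, hlin⟩ := exists_isLocallyLinear hB hf hg hθg hA1 hA2 hA3 hA4 hA5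
  refine ⟨?_, fun hK θhat hθhat ↦ ?_⟩
  · obtain ⟨θhat, hmeas, hzero, hcons⟩ := hlin.exists_root_seq hlaw hindep
    refine ⟨θhat, hmeas, ?_, hcons⟩
    refine tendsto_measure_zero_of_ae_imp hzero hzero
      ((eventually_ne_atTop 0).mono fun n hn ↦ ae_of_all _ fun a ha ↦ Or.inl fun h ↦ ha ?_)
    exact ⟨hA2.2.1 (hrω h.1), (hroot n hn _ _).1 h.2⟩
  · refine hlin.tendstoInDistribution_root hlaw hindep ?_ hθhat.measurable ?_ hθhat.consistent
    · refine tendstoInDistribution_inv_sqrt_smul_sum (h := fun x ↦ -normalizedScore μ B f g θg θg x)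
        hlaw hindep (memLp_neg_normalizedScore hg hK) ?_
        (posSemidef_sandwich hf hg hθg hA4 hK) (integral_inner_normalizedScore_sq hf hg hθg hA4 hK)
      rw [integral_neg, hlin.integral_center, neg_zero]
    · refine tendsto_measure_zero_of_ae_imp hθhat.root hθhat.root
        ((eventually_ne_atTop 0).mono fun n hn ↦ ae_of_all _ fun a ha ↦ Or.inl fun h ↦ ha ?_)
      exact (hroot n hn _ _).2 h.2
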